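/- **Theorem (strong CoIC-KLA security implies CoIC-KLA security).** Let $\mathsf{PKE}=(\mathsf{KG},\mathsf{Enc},\mathsf{Dec})$ be a public key encryption scheme (classical polynomial-time algorithms, $\mathsf{KG}$ and $\mathsf{Enc}$ probabilistic, $\mathsf{Dec}$ deterministic, decryption correct except with negligible probability) with nonempty message space $\mathcal X=\{\mathcal X_\lambda\}_\lambda$, where keys, messages and ciphertexts are bit strings of lengths determined by the security parameter $\lambda$. If $\mathsf{PKE}$ is $\epsilon$-strong CoIC-KLA secure for every inverse polynomial $\epsilon=\epsilon(\lambda)$ (that is, $\epsilon=1/p$ with $p$ a polynomial, positive on $\mathbb N$), then $\mathsf{PKE}$ is CoIC-KLA secure. The two notions are as follows; adversaries are uniform polynomial-time quantum algorithms (QPT). *CoIC-KLA security.* In the experiment, the challenger generates $(\mathsf{ek}_0,\mathsf{dk}_0)$ and $(\mathsf{ek}_1,\mathsf{dk}_1)$ by two independent runs of $\mathsf{KG}(1^\lambda)$ and sends $\mathsf{ek}_0$, $\mathsf{ek}_1$ and the state $|\mathsf{dk}\rangle=\frac1{\sqrt2}(|0\rangle|\mathsf{dk}_0\rangle+|1\rangle|\mathsf{dk}_1\rangle)$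 to the adversary. At most once, before it sends its messages, the adversary may submit a register to a verification oracle, which applies the measurement $(I-\Pi,\Pi)$ with $\Pi=|\mathsf{dk}\rangle\langle\mathsf{dk}|$ and returns the outcome, but not the register. Then the adversary sends $(m_0,m_1)\in\mathcal X_\lambda^2$, receives $\mathsf{ct}_0\leftarrow\mathsf{Enc}(\mathsf{ek}_0,m_a)$ and $\mathsf{ct}_1\leftarrow\mathsf{Enc}(\mathsf{ek}_1,m_{a\oplus b})$ for uniformly random bits $a,b$, and outputs a bit $b'$. The experiment outputs $1$ if $b'=b$ and $0$ otherwise. (If the adversary sends something outside $\mathcal X_\lambda^2$, the experiment outputs a random bit.) The scheme is CoIC-KLA secure if for every QPT adversary $2\left|\Pr[\text{output }1]-\frac12\right|$ is negligible in $\lambda$. *$\epsilon$-strong CoIC-KLA security.* In the experiment, the adversary receives $\mathsf{ek}_0$, $\mathsf{ek}_1$ and $|\mathsf{dk}\rangle$ generated as above (there is no oracle) and sends $(m_0,m_1)\in\mathcal X_\lambda^2$ together with a quantum program with classical inputs and one-bit outputs, that is, a quantum state $q$ and a compact classical description of unitaries $\{U_{\mathsf{ct}_0,\mathsf{ct}_1}\}$,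 from which $U_{\mathsf{ct}_0,\mathsf{ct}_1}$ can be applied efficiently given $(\mathsf{ct}_0,\mathsf{ct}_1)$; the output bit of the program is its first qubit. Let $D$ be the distribution of $(b,\mathsf{ct}_0,\mathsf{ct}_1)$ where $a,b$ are uniformly random bits, $\mathsf{ct}_0\leftarrow\mathsf{Enc}(\mathsf{ek}_0,m_a)$ and $\mathsf{ct}_1\leftarrow\mathsf{Enc}(\mathsf{ek}_1,m_{a\oplus b})$; let $\mathcal R$ be its set of random coins, put $P_{b,\mathsf{ct}_0,\mathsf{ct}_1}=U_{\mathsf{ct}_0,\mathsf{ct}_1}^\dagger(|b\rangle\langle b|\otimes I)U_{\mathsf{ct}_0,\mathsf{ct}_1}$ and $P_D=\sum_{r\in\mathcal R}\frac1{|\mathcal R|}P_{D(r)}$. The challenger applies to $q$ the projective implementation of the binary POVM $(P_D,I-P_D)$, that is, the projective measurement $\{E_p\}_p$ onto the eigenspaces of $P_D$, whose outcomes $p\in[0,1]$ are the eigenvalues (measuring $p$ and then outputting the first outcome with probability $p$ and the second with probability $1-p$ is equivalent to $(P_D,I-P_D)$). The experiment outputs $1$ if $p\ge\frac12+\epsilon(\lambda)$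 and $0$ otherwise. (If the adversary sends messages outside $\mathcal X_\lambda^2$, the output is $0$.) The scheme is $\epsilon$-strong CoIC-KLA secure if for every QPT adversary $\Pr[\text{output }1]$ is negligible in $\lambda$. -/

import Mathlib

open scoped Matrix BigOperators

noncomputable section

/-! ## Bit strings, averages, polynomial time -/

/-- Bit strings of length `l`. -/
abbrev Bits (l : ℕ) : Type := Fin l → Bool

/-- The expectation of `f` at a uniformly random point of a finite type. -/
def avg {α : Type} [Fintype α] (f : α → ℝ) : ℝ := (∑ x, f x) / Fintype.card α

/-- The encoding of a list of bit strings over the three-letter alphabet `Option Bool`: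
every string is followed by the separator `none`. -/
def encodeStrings (L : List (List Bool)) : List (Option Bool) :=
  L.flatMap fun s => s.map some ++ [none]

/-- The function `f`, whose values are lists of bit strings, is computed by a polynomial-time
Turing machine; the argument `a` is presented to the machine as the list of bit strings `inp a`. -/
def PolyTime {α : Type} (inp f : α → List (List Bool)) : Prop :=
  Nonempty (Turing.TM2ComputableInPolyTime (fun a => encodeStrings (inp a)) encodeStrings f)

/-- The security parameter `n` in unary. -/
def unary (n : ℕ) : List Bool := List.replicate n true

/-- A function of the security parameter is negligible if it vanishes faster than every
inverse polynomial. -/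
def Negligible (f : ℕ → ℝ) : Prop :=
  Asymptotics.SuperpolynomialDecay Filter.atTop (fun n : ℕ => (n : ℝ)) f

/-- Inverse polynomials: the functions `1 / p(n)` with `p` a polynomial, positive on `ℕ`. -/
def IsInversePolynomial (ε : ℕ → ℝ) : Prop :=
  ∃ p : Polynomial ℕ, ∀ n, 0 < p.eval n ∧ ε n = 1 / ((p.eval n : ℕ) : ℝ)

/-! ## Public key encryption -/

/-- A public key encryption scheme. Keys, messages and ciphertexts for the security parameter `n`
are bit strings of a length depending on `n` only (shorter strings being padded), the message space
is an arbitrary set of strings of length `msgLen n`, and probabilistic algorithms are deterministic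
polynomial-time algorithms with an explicit uniformly random string of polynomial length. -/
structure PKE where
  ekLen : ℕ → ℕ
  dkLen : ℕ → ℕ
  msgLen : ℕ → ℕ
  ctLen : ℕ → ℕ
  /-- The message space. -/
  msgSpace : ∀ n, Set (Bits (msgLen n))
  /-- The number of random bits used by key generation. -/
  kgCoins : Polynomial ℕ
  /-- The number of random bits used by encryption. -/
  encCoins : Polynomial ℕ
  /-- Key generation; it returns the encryption key and the decryption key. -/
  kg : ∀ n, Bits (kgCoins.eval n) → Bits (ekLen n) × Bits (dkLen n)
  enc : ∀ n, Bits (ekLen n) → Bits (msgLen n) → Bits (encCoins.eval n) → Bits (ctLen n)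
  /-- Decryption is deterministic; `none` signals failure. -/
  dec : ∀ n, Bits (dkLen n) → Bits (ctLen n) → Option (Bits (msgLen n))
  msgSpace_nonempty : ∀ n, (msgSpace n).Nonempty
  msgLen_poly : ∃ p : Polynomial ℕ, ∀ n, msgLen n ≤ p.eval n
  kg_poly : PolyTime (α := Σ n, Bits (kgCoins.eval n))
    (fun a => [unary a.1, List.ofFn a.2])
    (fun a => [List.ofFn (kg a.1 a.2).1, List.ofFn (kg a.1 a.2).2])
  enc_poly : PolyTime (α := Σ n, Bits (ekLen n) × Bits (msgLen n) × Bits (encCoins.eval n))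
    (fun a => [unary a.1, List.ofFn a.2.1, List.ofFn a.2.2.1, List.ofFn a.2.2.2])
    (fun a => [List.ofFn (enc a.1 a.2.1 a.2.2.1 a.2.2.2)])
  dec_poly : PolyTime (α := Σ n, Bits (dkLen n) × Bits (ctLen n))
    (fun a => [unary a.1, List.ofFn a.2.1, List.ofFn a.2.2])
    (fun a => (dec a.1 a.2.1 a.2.2).elim [] fun m => [List.ofFn m])
  correct : ∀ m : ∀ n, Bits (msgLen n), (∀ n, m n ∈ msgSpace n) →
    Negligible fun n => 1 - avg fun c : Bits (kgCoins.eval n) × Bits (encCoins.eval n) =>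
      if dec n (kg n c.1).2 (enc n (kg n c.1).1 (m n) c.2) = some (m n) then 1 else 0

/-! ## Quantum circuits on named registers -/

/-- The registers of an adversary: the two encryption keys, the leased decryption key, the answer
of the verification oracle, the two challenge messages, a classical string describing a quantum
program, the two challenge ciphertexts, the output bit, and work space. -/
inductive Reg
  | ek0 | ek1 | dk | ans | msg0 | msg1 | desc | ct0 | ct1 | out | work
  deriving DecidableEq

instance Reg.instFintype : Fintype Reg where
  elems := {.ek0, .ek1, .dk, .ans, .msg0, .msg1, .desc, .ct0, .ct1, .out, .work}
  complete := by rintro ⟨⟩ <;> decide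

/-- A qubit is addressed by the name of its register and its position there. -/
abbrev Wire : Type := Reg × ℕ

/-- Unitary gates: Hadamard, `π/8`, NOT and controlled NOT (first the control, then the target). -/
inductive Gate
  | H (w : Wire) | T (w : Wire) | X (w : Wire) | CNOT (c t : Wire)

/-- Instructions of a general quantum circuit: unitary gates, measurement of a qubit in the
computational basis, resetting a register to `|0…0⟩`, and a call of an oracle. -/
inductive Instr
  | gate (g : Gate) | measure (w : Wire) | reset (r : Reg) | query

/-- The alphabet in which circuits are written down. -/
inductive CircuitSym
  | H | T | X | CNOT | measure | reset | query | reg (r : Reg) | tick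

/-- A qubit is written as the name of its register followed by its position in unary. -/
def encodeWire (w : Wire) : List CircuitSym := .reg w.1 :: List.replicate w.2 .tick

def encodeGate : Gate → List CircuitSym
  | .H w => .H :: encodeWire w
  | .T w => .T :: encodeWire w
  | .X w => .X :: encodeWire w
  | .CNOT c t => .CNOT :: (encodeWire c ++ encodeWire t)

def encodeInstr : Instr → List CircuitSym
  | .gate g => encodeGate g
  | .measure w => .measure :: encodeWire w
  | .reset r => [.reset, .reg r]
  | .query => [.query]

/-- A family of general circuits is uniform if a polynomial-time Turing machine writes down the
`n`-th circuit, given `n` in unary. -/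
def UniformCircuits (C : ℕ → List Instr) : Prop :=
  Nonempty (Turing.TM2ComputableInPolyTime unary (fun c => c.flatMap encodeInstr) C)

/-- Uniformity for families of unitary circuits. -/
def UniformUnitaryCircuits (C : ℕ → List Gate) : Prop :=
  Nonempty (Turing.TM2ComputableInPolyTime unary (fun c => c.flatMap encodeGate) C)

/-! ## Semantics of circuits

`sz r` is the number of qubits of the register `r`. States are (subnormalised) density matrices. -/

section Semantics

variable {sz : Reg → ℕ}

/-- The computational basis: an assignment of a bit string to every register. -/
abbrev Basis (sz : Reg → ℕ) : Type := ∀ r, Bits (sz r)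

/-- Operators on the state space. -/
abbrev Op (sz : Reg → ℕ) : Type := Matrix (Basis sz) (Basis sz) ℂ

/-- Overwrite one bit of a basis state. -/
def setBit (x : Basis sz) (r : Reg) (i : Fin (sz r)) (b : Bool) : Basis sz :=
  Function.update x r (Function.update (x r) i b)

/-- The operator that maps the basis vector `|y⟩` to `|f y⟩`. -/
def basisMapOp (f : Basis sz → Basis sz) : Op sz :=
  Matrix.of fun x y => if x = f y then 1 else 0

def hadamardOp (r : Reg) (i : Fin (sz r)) : Op sz :=
  Matrix.of fun x y =>
    if x = setBit y r i (x r i) then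
      (if x r i = true ∧ y r i = true then -1 else 1) / (Real.sqrt 2 : ℂ)
    else 0

def tOp (r : Reg) (i : Fin (sz r)) : Op sz :=
  Matrix.diagonal fun x => if x r i then Complex.exp (Complex.I * Real.pi / 4) else 1

def xOp (r : Reg) (i : Fin (sz r)) : Op sz :=
  basisMapOp fun y => setBit y r i (!(y r i))

def cnotOp (r : Reg) (i : Fin (sz r)) (r' : Reg) (j : Fin (sz r')) : Op sz :=
  basisMapOp fun y => setBit y r' j (xor (y r' j) (y r i))

/-- The unitary operator of a gate. A gate addressing a qubit that does not exist, and a controlled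
NOT whose control is its target, do nothing. -/
def gateOp (sz : Reg → ℕ) : Gate → Op sz
  | .H (r, i) => if h : i < sz r then hadamardOp r ⟨i, h⟩ else 1
  | .T (r, i) => if h : i < sz r then tOp r ⟨i, h⟩ else 1
  | .X (r, i) => if h : i < sz r then xOp r ⟨i, h⟩ else 1
  | .CNOT (r, i) (r', j) =>
      if h : (i < sz r ∧ j < sz r') ∧ (r, i) ≠ (r', j) then
        cnotOp r ⟨i, h.1.1⟩ r' ⟨j, h.1.2⟩
      else 1

/-- The unitary operator of a circuit; the head of the list is applied first. -/
def circuitOp (sz : Reg → ℕ) : List Gate → Op sz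
  | [] => 1
  | g :: c => circuitOp sz c * gateOp sz g

/-- Measure a qubit in the computational basis and forget the outcome. -/
def measureQubit (r : Reg) (i : Fin (sz r)) (ρ : Op sz) : Op sz :=
  Matrix.of fun x y => if x r i = y r i then ρ x y else 0

/-- Discard the content of a register (partial trace) and reinitialise it to `|0…0⟩`. -/
def resetReg (r : Reg) (ρ : Op sz) : Op sz :=
  Matrix.of fun x y =>
    if x r = (fun _ => false) ∧ y r = (fun _ => false) then
      ∑ s : Bits (sz r), ρ (Function.update x r s) (Function.update y r s)
    else 0

/-- One instruction, as a transformation of density matrices; `O` is the oracle. -/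
def runInstr (O : Op sz → Op sz) : Instr → Op sz → Op sz
  | .gate g, ρ => gateOp sz g * ρ * (gateOp sz g)ᴴ
  | .measure (r, i), ρ => if h : i < sz r then measureQubit r ⟨i, h⟩ ρ else ρ
  | .reset r, ρ => resetReg r ρ
  | .query, ρ => O ρ

/-- A general circuit, as a transformation of density matrices. -/
def runCircuit (O : Op sz → Op sz) : List Instr → Op sz → Op sz
  | [], ρ => ρ
  | i :: c, ρ => runCircuit O c (runInstr O i ρ)

/-- The projection onto the states in which the register `r` contains the string `s`. -/
def regProj (r : Reg) (s : Bits (sz r)) : Op sz :=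
  Matrix.diagonal fun x => if x r = s then 1 else 0

/-- The projection onto the states in which the output qubit is `b`, that is `|b⟩⟨b| ⊗ I`. -/
def outProj (sz : Reg → ℕ) (b : Bool) : Op sz :=
  Matrix.diagonal fun x => if ∀ i, x .out i = b then 1 else 0

/-- The unitary `|y⟩ ↦ |y ⊕ s⟩` on the register `r`. It delivers the classical string `s` in a
register that is `|0…0⟩`. -/
def writeOp (r : Reg) (s : Bits (sz r)) : Op sz :=
  basisMapOp fun y => Function.update y r fun i => xor (y r i) (s i)

/-! ### The leased key and the verification oracle -/

/-- The amplitudes of the state `(|0⟩|k₀⟩ + |1⟩|k₁⟩) / √2`. -/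
def leasedKey {d : ℕ} (k₀ k₁ : Bits d) (s : Bits (d + 1)) : ℂ :=
  ((if s = Fin.cons (α := fun _ => Bool) false k₀ then 1 else 0) +
    (if s = Fin.cons (α := fun _ => Bool) true k₁ then 1 else 0)) / (Real.sqrt 2 : ℂ)

/-- The operator `|χ⟩⟨χ|` on the key register (and the identity on the others). -/
def verifyProj (χ : Bits (sz .dk) → ℂ) : Op sz :=
  Matrix.of fun x y =>
    if x = Function.update y .dk (x .dk) then χ (x .dk) * star (χ (y .dk)) else 0

/-- The verification oracle. The adversary hands in its key register; the binary measurement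
`(I - Π, Π)` with `Π = |χ⟩⟨χ|` is applied to it, the register is not given back (the adversary finds
an empty one in its place), and the outcome (`1` if the state was projected onto `Π`) is stored in
the answer register. -/
def verifyOracle (χ : Bits (sz .dk) → ℂ) (ρ : Op sz) : Op sz :=
  let no : Op sz := resetReg .ans (resetReg .dk ((1 - verifyProj χ) * ρ * (1 - verifyProj χ)))
  let yes : Op sz := resetReg .ans (resetReg .dk (verifyProj χ * ρ * verifyProj χ))
  no + gateOp sz (.X (.ans, 0)) * yes * (gateOp sz (.X (.ans, 0)))ᴴ

/-- The initial vector: encryption keys `e₀`, `e₁`, the state `χ` in the key register, and zeros in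
all other registers. -/
def initialVec (e₀ : Bits (sz .ek0)) (e₁ : Bits (sz .ek1)) (χ : Bits (sz .dk) → ℂ) :
    Basis sz → ℂ := fun x =>
  if x .ek0 = e₀ ∧ x .ek1 = e₁ ∧
      ∀ r, r ≠ .ek0 → r ≠ .ek1 → r ≠ .dk → x r = (fun _ => false) then
    χ (x .dk)
  else 0

/-- The initial density matrix. -/
def initialState (e₀ : Bits (sz .ek0)) (e₁ : Bits (sz .ek1)) (χ : Bits (sz .dk) → ℂ) : Op sz :=
  Matrix.vecMulVec (initialVec e₀ e₁ χ) (star (initialVec e₀ e₁ χ))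

end Semantics

/-! ## Projective implementation of binary measurements -/

section ProjImp

variable {ι : Type} [Fintype ι] [DecidableEq ι]

/-- `E`, with outcomes in the finite set `S`, is a projective implementation of the binary POVM
`(P, 1 - P)`. A probability distribution on the two outcomes is represented by the probability
`p ∈ [0, 1]` of the first one. The family `E` is a projective measurement, and measuring `E` and
then sampling from the distribution obtained is equivalent to `(P, 1 - P)`. -/
structure IsProjectiveImplementation (P : Matrix ι ι ℂ) (S : Finset ℝ)
    (E : ℝ → Matrix ι ι ℂ) : Prop where
  mem_unit : ∀ p ∈ S, 0 ≤ p ∧ p ≤ 1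
  hermitian : ∀ p ∈ S, (E p).IsHermitian
  idempotent : ∀ p ∈ S, E p * E p = E p
  orthogonal : ∀ p ∈ S, ∀ q ∈ S, p ≠ q → E p * E q = 0
  sum_eq_one : ∑ p ∈ S, E p = 1
  sample_fst : ∑ p ∈ S, (p : ℂ) • E p = P
  sample_snd : ∑ p ∈ S, ((1 - p : ℝ) : ℂ) • E p = 1 - P

/-- The outcomes of the projective implementation of `(P, 1 - P)`: the eigenvalues of `P`. -/
def projImpOutcomes (P : Matrix ι ι ℂ) : Finset ℝ := P.finite_real_spectrum.toFinset

/-- The projective implementation of `(P, 1 - P)`: the outcome `p` belongs to the orthogonal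
projection onto the eigenspace of `P` for `p`. -/
def projImp (P : Matrix ι ι ℂ) (p : ℝ) : Matrix ι ι ℂ :=
  (Matrix.toEuclideanCLM (n := ι) (𝕜 := ℂ)).symm
    (Module.End.eigenspace (Matrix.toEuclideanLin P) (p : ℂ)).starProjection

open scoped ComplexOrder in
/-- The projections onto the eigenspaces are a projective implementation. -/
theorem isProjectiveImplementation_projImp {P : Matrix ι ι ℂ} (hP : P.PosSemidef)
    (hP' : (1 - P).PosSemidef) :
    IsProjectiveImplementation P (projImpOutcomes P) (projImp P) := by
  set Φ := Matrix.toEuclideanCLM (n := ι) (𝕜 := ℂ) with hΦ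
  set T := Matrix.toEuclideanLin P with hTdef
  have hT : T.IsSymmetric := Matrix.isSymmetric_toEuclideanLin_iff.mpr hP.isHermitian
  have hΦP : ∀ x, Φ P x = T x := fun x => rfl
  have hE : ∀ p, projImp P p = Φ.symm (Module.End.eigenspace T (p : ℂ)).starProjection :=
    fun p => rfl
  have hortho : ∀ p q : ℂ, p ≠ q → Module.End.eigenspace T p ⟂ Module.End.eigenspace T q :=
    fun p q hpq => hT.orthogonalFamily_eigenspaces.isOrtho hpq
  have hmemS : ∀ p : ℝ, Module.End.HasEigenvalue T (p : ℂ) → p ∈ projImpOutcomes P := by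
    intro p hp
    have h1 : (p : ℂ) ∈ spectrum ℂ P := by
      rw [← Matrix.spectrum_toLpLin 2]
      exact hp.mem_spectrum
    simp only [projImpOutcomes, Set.Finite.mem_toFinset]
    rw [← spectrum.preimage_algebraMap ℂ]
    exact h1
  have hsum : ∀ x, ∑ p ∈ projImpOutcomes P,
      (Module.End.eigenspace T (p : ℂ)).starProjection x = x := by
    intro x
    have hx : x ∈ ⨆ μ, Module.End.eigenspace T μ := by
      rw [Submodule.orthogonal_eq_bot_iff.mp hT.orthogonalComplement_iSup_eigenspaces_eq_bot]
      trivial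
    induction hx using Submodule.iSup_induction' with
    | mem μ x hx =>
      by_cases hx0 : x = 0
      · simp [hx0]
      have hev : Module.End.HasEigenvalue T μ :=
        Module.End.hasEigenvalue_of_hasEigenvector ⟨hx, hx0⟩
      have hμ : ((μ.re : ℝ) : ℂ) = μ := Complex.conj_eq_iff_re.mp (hT.conj_eigenvalue_eq_self hev)
      rw [Finset.sum_eq_single_of_mem μ.re (hmemS _ (hμ.symm ▸ hev))]
      · rw [hμ]; exact Submodule.starProjection_eq_self_iff.mpr hx
      · intro q _ hq
        have hne : (q : ℂ) ≠ μ := fun h => hq (by rw [← h]; simp)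
        rw [Submodule.starProjection_apply_eq_zero_iff]
        exact (hortho _ _ hne).symm hx
    | zero => simp
    | add x y _ _ hx hy =>
      simp_rw [map_add, Finset.sum_add_distrib]
      exact congr_arg₂ (· + ·) hx hy
  have hone : ∑ p ∈ projImpOutcomes P, projImp P p = 1 := by
    simp_rw [hE]
    rw [← map_sum, ← map_one Φ.symm]
    congr 1
    ext1 x
    simpa using hsum x
  have hfst : ∑ p ∈ projImpOutcomes P, (p : ℂ) • projImp P p = P := by
    suffices h : Φ (∑ p ∈ projImpOutcomes P, (p : ℂ) • projImp P p) = Φ P from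
      EquivLike.injective Φ h
    ext1 x
    rw [hΦP]
    conv_rhs => rw [← hsum x, map_sum]
    simp only [map_sum, map_smul, hE, StarAlgEquiv.apply_symm_apply,
      sum_apply, smul_apply]
    refine Finset.sum_congr rfl fun p _ => ?_
    exact (Module.End.mem_eigenspace_iff.mp (Submodule.starProjection_apply_mem _ x)).symm
  refine ⟨?_, ?_, ?_, ?_, hone, hfst, ?_⟩
  · intro p hp
    simp only [projImpOutcomes, Set.Finite.mem_toFinset] at hp
    have key : ∀ A : Matrix ι ι ℂ, A.PosSemidef → ∀ r ∈ spectrum ℝ A, 0 ≤ r := by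
      intro A hA r hr
      rw [hA.isHermitian.spectrum_real_eq_range_eigenvalues] at hr
      obtain ⟨i, rfl⟩ := hr
      exact hA.eigenvalues_nonneg i
    refine ⟨key P hP p hp, ?_⟩
    have h2 : (1 - p) ∈ spectrum ℝ (1 - P) := by
      have := (spectrum.singleton_sub_eq (R := ℝ) P 1)
      rw [map_one] at this
      rw [← this]
      exact Set.sub_mem_sub rfl hp
    linarith [key _ hP' _ h2]
  · intro p _
    have h := isSelfAdjoint_starProjection (Module.End.eigenspace T (p : ℂ))
    change star (projImp P p) = projImp P p
    rw [hE]
    exact (map_star Φ.symm (Module.End.eigenspace T (p : ℂ)).starProjection).symm.trans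
      (congrArg Φ.symm h)
  · intro p _
    rw [hE, ← map_mul]
    exact congrArg _ (Submodule.isIdempotentElem_starProjection _)
  · intro p _ q _ hpq
    have hne : (p : ℂ) ≠ q := fun h => hpq (by exact_mod_cast h)
    rw [hE, hE, ← map_mul]
    have := (hortho _ _ hne).starProjection_comp_starProjection
    rw [ContinuousLinearMap.mul_def, this, map_zero]
  · simp only [Complex.ofReal_sub, Complex.ofReal_one, sub_smul, one_smul, Finset.sum_sub_distrib,
      hone, hfst]

end ProjImp

/-! ## The two experiments -/

namespace PKE

variable (S : PKE)

/-- The sizes of the registers, for work space of `work` and program descriptions of `desc`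
qubits. -/
def layout (work desc n : ℕ) : Reg → ℕ
  | .ek0 => S.ekLen n
  | .ek1 => S.ekLen n
  | .dk => S.dkLen n + 1
  | .ans => 1
  | .msg0 => S.msgLen n
  | .msg1 => S.msgLen n
  | .desc => desc
  | .ct0 => S.ctLen n
  | .ct1 => S.ctLen n
  | .out => 1
  | .work => work

/-- The unitary `U_{ct₀, ct₁}` of a quantum program with classical inputs: write the inputs into the
ciphertext registers, then run the circuit `prog`. -/
def programOp {work desc n : ℕ} (prog : List Gate) (ct₀ ct₁ : Bits (S.ctLen n)) :
    Op (S.layout work desc n) :=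
  circuitOp _ prog * (writeOp (sz := S.layout work desc n) .ct1 ct₁ *
    writeOp (sz := S.layout work desc n) .ct0 ct₀)

/-- The projection `P_{b, ct₀, ct₁} = U† (|b⟩⟨b| ⊗ I) U`, where `U = U_{ct₀, ct₁}`. -/
def guessProj {work desc n : ℕ} (prog : List Gate) (b : Bool) (ct₀ ct₁ : Bits (S.ctLen n)) :
    Op (S.layout work desc n) :=
  (S.programOp prog ct₀ ct₁)ᴴ * outProj _ b * S.programOp prog ct₀ ct₁

/-- The random coins of the challenge: the bits `a`, `b` and the coins of two encryptions. -/
abbrev ChalCoins (n : ℕ) : Type :=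
  Bool × Bool × Bits (S.encCoins.eval n) × Bits (S.encCoins.eval n)

/-- The challenge: the bit `b`, an encryption of `m_a` under `e₀` and one of `m_{a ⊕ b}` under
`e₁`. -/
def challenge {n : ℕ} (e₀ e₁ : Bits (S.ekLen n)) (m₀ m₁ : Bits (S.msgLen n)) :
    S.ChalCoins n → Bool × Bits (S.ctLen n) × Bits (S.ctLen n)
  | (a, b, r₀, r₁) =>
    (b, S.enc n e₀ (if a then m₁ else m₀) r₀, S.enc n e₁ (if xor a b then m₁ else m₀) r₁)

/-- An efficient quantum adversary for the CoIC-KLA experiment, given by two uniform families of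
circuits: a general circuit that is run before the messages are sent and calls the verification
oracle at most once, and a unitary circuit that is run on the challenge. -/
structure CoICAdversary where
  /-- The number of work qubits. -/
  work : Polynomial ℕ
  pre : ℕ → List Instr
  post : ℕ → List Gate
  pre_uniform : UniformCircuits pre
  post_uniform : UniformUnitaryCircuits post
  one_query : ∀ n, ((pre n).filter fun i => i matches .query).length ≤ 1

/-- An efficient quantum adversary for the strong CoIC-KLA experiment: a uniform family of general
circuits without oracle calls, after which the registers `msg0`, `msg1` and `desc` are measured and
sent, and a uniform family of unitary circuits which applies the unitary `U_{ct₀, ct₁}` of the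
program, given its description in the register `desc` and the inputs `ct₀, ct₁`. -/
structure StrongAdversary where
  /-- The number of work qubits. -/
  work : Polynomial ℕ
  /-- The length of the classical description of the program. -/
  desc : Polynomial ℕ
  pre : ℕ → List Instr
  prog : ℕ → List Gate
  pre_uniform : UniformCircuits pre
  prog_uniform : UniformUnitaryCircuits prog
  no_query : ∀ n, Instr.query ∉ pre n

/-- The (subnormalised) state of the CoIC-KLA adversary after it has sent the messages `m₀`, `m₁`;
its trace is the probability of these messages. -/
def coicState (A : CoICAdversary) (n : ℕ) (k₀ k₁ : Bits (S.ekLen n) × Bits (S.dkLen n))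
    (m₀ m₁ : Bits (S.msgLen n)) : Op (S.layout (A.work.eval n) 0 n) :=
  let sz := S.layout (A.work.eval n) 0 n
  let χ : Bits (sz .dk) → ℂ := leasedKey k₀.2 k₁.2
  let ρ : Op sz := runCircuit (verifyOracle χ) (A.pre n) (initialState (sz := sz) k₀.1 k₁.1 χ)
  let M : Op sz := regProj (sz := sz) .msg0 m₀ * regProj (sz := sz) .msg1 m₁
  M * ρ * M

open Classical in
/-- The probability that the CoIC-KLA experiment outputs `1`. If the adversary does not send
messages of the message space, the experiment is aborted and its output is a random bit. -/
def coicProb (A : CoICAdversary) (n : ℕ) : ℝ :=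
  avg fun c : Bits (S.kgCoins.eval n) × Bits (S.kgCoins.eval n) =>
    let k₀ := S.kg n c.1
    let k₁ := S.kg n c.2
    ∑ m₀ : Bits (S.msgLen n), ∑ m₁ : Bits (S.msgLen n),
      if m₀ ∈ S.msgSpace n ∧ m₁ ∈ S.msgSpace n then
        avg fun r : S.ChalCoins n =>
          let t := S.challenge k₀.1 k₁.1 m₀ m₁ r
          (Matrix.trace (S.guessProj (A.post n) t.1 t.2.1 t.2.2 *
            S.coicState A n k₀ k₁ m₀ m₁)).re
      else (1 / 2) * (Matrix.trace (S.coicState A n k₀ k₁ m₀ m₁)).re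

/-- CoIC-KLA security. -/
def IsCoICKLASecure : Prop :=
  ∀ A : CoICAdversary, Negligible fun n => 2 * |S.coicProb A n - 1 / 2|

/-- The (subnormalised) state `q` sent by the strong CoIC-KLA adversary along with the messages
`m₀`, `m₁` and the description `u` of a program. -/
def strongState (A : StrongAdversary) (n : ℕ) (k₀ k₁ : Bits (S.ekLen n) × Bits (S.dkLen n))
    (m₀ m₁ : Bits (S.msgLen n)) (u : Bits (A.desc.eval n)) :
    Op (S.layout (A.work.eval n) (A.desc.eval n) n) :=
  let sz := S.layout (A.work.eval n) (A.desc.eval n) n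
  let χ : Bits (sz .dk) → ℂ := leasedKey k₀.2 k₁.2
  let ρ : Op sz := runCircuit id (A.pre n) (initialState (sz := sz) k₀.1 k₁.1 χ)
  let M : Op sz := regProj (sz := sz) .msg0 m₀ * regProj (sz := sz) .msg1 m₁ *
    regProj (sz := sz) .desc u
  M * ρ * M

/-- The operator `P_D = ∑_r |R|⁻¹ P_{D(r)}`, where `D` is the distribution of the challenge. -/
def mixedProj {work desc n : ℕ} (prog : List Gate) (e₀ e₁ : Bits (S.ekLen n))
    (m₀ m₁ : Bits (S.msgLen n)) : Op (S.layout work desc n) :=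
  ∑ r : S.ChalCoins n, ((Fintype.card (S.ChalCoins n) : ℂ))⁻¹ •
    (let t := S.challenge e₀ e₁ m₀ m₁ r
     S.guessProj prog t.1 t.2.1 t.2.2)

open Classical in
/-- The probability that the strong CoIC-KLA experiment with parameter `ε` outputs `1`: the
projective implementation of `(P_D, 1 - P_D)`, applied to the state of the program sent by the
adversary, returns some `p ≥ 1/2 + ε`. If the adversary does not send messages of the message space,
the experiment outputs `0`. -/
def strongProb (A : StrongAdversary) (ε : ℝ) (n : ℕ) : ℝ :=
  avg fun c : Bits (S.kgCoins.eval n) × Bits (S.kgCoins.eval n) =>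
    let k₀ := S.kg n c.1
    let k₁ := S.kg n c.2
    ∑ m₀ : Bits (S.msgLen n), ∑ m₁ : Bits (S.msgLen n), ∑ u : Bits (A.desc.eval n),
      if m₀ ∈ S.msgSpace n ∧ m₁ ∈ S.msgSpace n then
        let P : Op (S.layout (A.work.eval n) (A.desc.eval n) n) :=
          S.mixedProj (A.prog n) k₀.1 k₁.1 m₀ m₁
        ∑ p ∈ (projImpOutcomes P).filter (fun p => 1 / 2 + ε ≤ p),
          (Matrix.trace (projImp P p * S.strongState A n k₀ k₁ m₀ m₁ u)).re
      else 0

/-- `ε`-strong CoIC-KLA security. -/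
def IsStrongCoICKLASecure (ε : ℕ → ℝ) : Prop :=
  ∀ A : StrongAdversary, Negligible fun n => S.strongProb A (ε n) n

end PKE

end

/-! The verification oracle can be called only once and keeps the register handed in, so its one-bit
answer can be guessed. Replace the call by discarding the key register and writing a constant `v`
into the answer register (`constantAnswer`). Let `R` discard the key register and clear the answer,
and let `X` flip the answer bit. The true oracle gives `R(no) + X R(yes) X†`. Since `R(no) + R(yes)
= R(ρ)` (`resetReg_dk_verifyProj`), the two guesses together exceed it by `R(yes) + X R(no) X† ≥ 0`.
The rest of the run is additive and preserves positivity, so the adversary's state `σ` satisfies `σ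
≤ σ₀ + σ₁`, where `σ_v` is its state under the guess `v` (`posSemidef_guess_sub_runCircuit`). This
operator inequality replaces any analysis of which guess is right; its price is a factor two in
probability.

Let `P = P_D` and let `E_p` be its spectral projections. A correct guess of `b` has weight `tr(Pσ) =
∑ p tr(E_p σ)`. With `c = 1/2 + ε`, bound the eigenvalues below `c` by `c` and the others by `1`,
then apply `σ ≤ σ₀ + σ₁` to the latter (`re_trace_mul_le`). The remainder is the success probability
of two strong adversaries, which run the first circuit with a guessed answer and send the second
circuit as the program. Negating the output bit turns `P` into `1 - P`, and two more strong
adversaries then bound the success probability from below. Together they give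
`abs_coicProb_sub_half_le`. To defeat the factor `n^k` in the definition of negligibility, take `ε =
1 / (n^(k+1) + 1)`.

The strong adversaries must again be uniform. On written circuits the reduction only substitutes a
word for the symbol `query` and appends a word, and `TM2ComputableInPolyTime.subst_append` shows
that polynomial-time machines are closed under this. -/

noncomputable section

/-! ## Post-processing the output of a Turing machine -/

namespace Turing.TM2

open Function Stmt

variable {K : Type} {Γ : K → Type} {Λ σ : Type}

/-- The stack alphabets of a machine with one additional stack, whose alphabet is that of `k₁`. -/
@[reducible] def auxAlphabet (Γ : K → Type) (k₁ : K) : K ⊕ Unit → Type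
  | .inl k => Γ k
  | .inr _ => Γ k₁

/-- Stacks for the enlarged machine. -/
def auxStk {k₁ : K} (S : ∀ k, List (Γ k)) (T : List (Γ k₁)) : ∀ k, List (auxAlphabet Γ k₁ k)
  | .inl k => S k
  | .inr _ => T

/-- A statement, run on the enlarged machine; instead of halting it jumps to `Sum.inr false`. -/
def redirectHalt (k₁ : K) : Stmt Γ Λ σ →
    Stmt (auxAlphabet Γ k₁) (Λ ⊕ Bool) (σ × Option (Γ k₁))
  | push k f q => push (.inl k) (fun v => f v.1) (redirectHalt k₁ q)
  | peek k f q => peek (.inl k) (fun v s => (f v.1 s, v.2)) (redirectHalt k₁ q)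
  | pop k f q => pop (.inl k) (fun v s => (f v.1 s, v.2)) (redirectHalt k₁ q)
  | load f q => load (fun v => (f v.1, v.2)) (redirectHalt k₁ q)
  | branch f q₁ q₂ => branch (fun v => f v.1) (redirectHalt k₁ q₁) (redirectHalt k₁ q₂)
  | goto l => goto fun v => .inl (l v.1)
  | halt => goto fun _ => .inr false

/-- Push a list of symbols, the last one first, so that they are read in the given order. -/
def pushList (k : K) (L : List (Γ k)) (q : Stmt Γ Λ σ) : Stmt Γ Λ σ :=
  L.foldl (fun q a => push k (fun _ => a) q) q

/-- Run `m`. Then move its output to the additional stack, write `z`, and move the output back,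
replacing the symbol `a₀` by the word `w`. -/
def postProcess [DecidableEq K] {k₁ : K} [DecidableEq (Γ k₁)] (m : Λ → Stmt Γ Λ σ)
    (a₀ : Γ k₁) (w z : List (Γ k₁)) :
    Λ ⊕ Bool → Stmt (auxAlphabet Γ k₁) (Λ ⊕ Bool) (σ × Option (Γ k₁))
  | .inl l => redirectHalt k₁ (m l)
  | .inr false =>
      pop (.inl k₁) (fun v s => (v.1, s)) <|
        branch (fun v => v.2.isSome)
          -- The default `a₀` is never used: this branch is taken only if a symbol was popped.
          (push (.inr ()) (fun v => v.2.getD a₀) (goto fun _ => .inr false))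
          (pushList (Γ := auxAlphabet Γ k₁) (.inl k₁) z (goto fun _ => .inr true))
  | .inr true =>
      pop (.inr ()) (fun v s => (v.1, s)) <|
        branch (fun v => v.2.isSome)
          (branch (fun v => v.2.elim false fun a => decide (a = a₀))
            (pushList (Γ := auxAlphabet Γ k₁) (.inl k₁) w (goto fun _ => .inr true))
            (push (.inl k₁) (fun v => v.2.getD a₀) (goto fun _ => .inr true)))
          halt

/-- A bound on the number of symbols pushed by a statement. -/
def pushCount : Stmt Γ Λ σ → ℕ
  | push _ _ q => pushCount q + 1
  | peek _ _ q => pushCount q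
  | pop _ _ q => pushCount q
  | load _ q => pushCount q
  | branch _ q₁ q₂ => max (pushCount q₁) (pushCount q₂)
  | goto _ => 0
  | halt => 0

/-- A configuration of the original machine as one of the enlarged machine. -/
def auxCfg {k₁ : K} (o : Option (Γ k₁)) (T : List (Γ k₁)) (c : Cfg Γ Λ σ) :
    Cfg (auxAlphabet Γ k₁) (Λ ⊕ Bool) (σ × Option (Γ k₁)) where
  l := some (c.l.elim (.inr false) .inl)
  var := (c.var, o)
  stk := auxStk c.stk T

/-! ### Step-by-step simulation and output length -/

variable [DecidableEq K]

theorem update_auxStk_inl {k₁ : K} (S : ∀ k, List (Γ k)) (T : List (Γ k₁)) (k : K)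
    (L : List (Γ k)) :
    update (auxStk S T) (Sum.inl k) L = auxStk (update S k L) T := by
  funext j
  rcases j with j | j
  · by_cases h : j = k
    · subst h; simp [auxStk]
    · rw [update_of_ne (by simpa using h)]
      simp [auxStk, h]
  · rw [update_of_ne (by simp)]; rfl

theorem update_auxStk_inr {k₁ : K} (S : ∀ k, List (Γ k)) (T L : List (Γ k₁)) :
    update (auxStk S T) (Sum.inr ()) L = auxStk S L := by
  funext j
  rcases j with j | j
  · rw [update_of_ne (by simp)]; rfl
  · simp [auxStk]

/-- No statement of the original machine touches the additional stack or the additional memory cell,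
so the simulation is exact and costs no extra steps. -/
theorem stepAux_redirectHalt {k₁ : K} (o : Option (Γ k₁)) (T : List (Γ k₁)) (q : Stmt Γ Λ σ) :
    ∀ v S, stepAux (redirectHalt k₁ q) (v, o) (auxStk S T) = auxCfg o T (stepAux q v S) := by
  induction q with
  | push k f q ih =>
    intro v S
    simp only [redirectHalt, stepAux]
    rw [update_auxStk_inl]; exact ih _ _
  | peek k f q ih => intro v S; exact ih _ _
  | pop k f q ih =>
    intro v S
    simp only [redirectHalt, stepAux]
    rw [update_auxStk_inl]; exact ih _ _
  | load f q ih => intro v S; exact ih _ _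
  | branch f q₁ q₂ ih₁ ih₂ =>
    intro v S
    simp only [redirectHalt, stepAux]
    cases f v
    · exact ih₂ _ _
    · exact ih₁ _ _
  | goto l => intro v S; rfl
  | halt => intro v S; rfl

theorem stepAux_pushList (k : K) (v : σ) (L : List (Γ k)) :
    ∀ (q : Stmt Γ Λ σ) (S : ∀ k, List (Γ k)),
      stepAux (pushList k L q) v S = stepAux q v (update S k (L ++ S k)) := by
  induction L with
  | nil => intro q S; simp [pushList]
  | cons a L ih =>
    intro q S
    have := ih (push k (fun _ => a) q) S
    simp only [pushList, List.foldl_cons] at this ⊢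
    rw [this]
    simp

theorem length_stepAux_le (k : K) (q : Stmt Γ Λ σ) :
    ∀ v S, ((stepAux q v S).stk k).length ≤ (S k).length + pushCount q := by
  have hupd : ∀ (S : ∀ k, List (Γ k)) j (L : List (Γ j)) n, L.length ≤ (S j).length + n →
      (update S j L k).length ≤ (S k).length + n := by
    intro S j L n h
    by_cases hj : k = j
    · subst hj; simpa using h
    · rw [update_of_ne hj]; omega
  induction q with
  | push j f q ih =>
    intro v S
    refine (ih _ _).trans ?_
    have := hupd S j (f v :: S j) 1 (by simp)
    simp only [pushCount]; omega
  | peek j f q ih => intro v S; exact ih _ _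
  | pop j f q ih =>
    intro v S
    refine (ih _ _).trans ?_
    have := hupd S j (S j).tail 0 (by simp)
    simp only [pushCount]; omega
  | load f q ih => intro v S; exact ih _ _
  | branch f q₁ q₂ ih₁ ih₂ =>
    intro v S
    simp only [stepAux, pushCount]
    cases f v
    · exact (ih₂ _ _).trans (by simp)
    · exact (ih₁ _ _).trans (by simp)
  | goto l => intro v S; simp [pushCount]
  | halt => intro v S; simp [pushCount]

theorem iterate_bind_succ {C : Type} (f : C → Option C) (n : ℕ) (a : C) :
    (flip bind f)^[n + 1] (some a) = (flip bind f)^[n] (f a) := by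
  rw [Function.iterate_succ_apply]; rfl

theorem iterate_bind_none {C : Type} (f : C → Option C) (n : ℕ) :
    (flip bind f)^[n] none = none := by
  induction n with
  | zero => rfl
  | succ n ih => rw [Function.iterate_succ_apply]; exact ih

/-- One step may push several symbols, so the running time alone does not bound the output length;
the time multiplied by the largest number of pushes per step does. The cost of moving the output is
estimated this way. -/
theorem length_iterate_step_le (k : K) (m : Λ → Stmt Γ Λ σ) (N : ℕ)
    (hN : ∀ l, pushCount (m l) ≤ N) (n : ℕ) : ∀ a b : Cfg Γ Λ σ,
      (flip bind (step m))^[n] (some a) = some b →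
        (b.stk k).length ≤ (a.stk k).length + n * N := by
  induction n with
  | zero => rintro a b ⟨⟩; simp
  | succ n ih =>
    rintro ⟨l, v, S⟩ b h
    rw [iterate_bind_succ] at h
    cases l with
    | none => exact absurd ((iterate_bind_none (step m) n).symm.trans h) (by simp)
    | some l =>
      have h1 := ih _ _ h
      have h2 := length_stepAux_le k (m l) v S
      have h3 := hN l
      simp only at h1 h2 ⊢
      linarith

section

variable {k₁ : K} [DecidableEq (Γ k₁)] (m : Λ → Stmt Γ Λ σ) (a₀ : Γ k₁) (w z : List (Γ k₁))

theorem iterate_step_postProcess (o : Option (Γ k₁)) (T : List (Γ k₁)) (n : ℕ) :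
    ∀ a b : Cfg Γ Λ σ, (flip bind (step m))^[n] (some a) = some b →
      (flip bind (step (postProcess m a₀ w z)))^[n] (some (auxCfg o T a)) =
        some (auxCfg o T b) := by
  induction n with
  | zero => rintro a b ⟨⟩; rfl
  | succ n ih =>
    rintro ⟨l, v, S⟩ b h
    rw [iterate_bind_succ] at h ⊢
    cases l with
    | none => exact absurd ((iterate_bind_none (step m) n).symm.trans h) (by simp)
    | some l =>
      refine Eq.trans ?_ (ih _ _ h)
      exact congrArg (fun c => (flip bind (step (postProcess m a₀ w z)))^[n] (some c))
        (stepAux_redirectHalt o T (m l) v S)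

/-- Moving a stack to another reverses it. The extra step is the one that finds the stack empty; it
also lays down `z`, on top of which the output will be rebuilt. -/
theorem iterate_step_collect (v : σ) (S : ∀ k, List (Γ k)) : ∀ (L T : List (Γ k₁))
    (o : Option (Γ k₁)),
      (flip bind (step (postProcess m a₀ w z)))^[L.length + 1]
        (some ⟨some (.inr false), (v, o), auxStk (update S k₁ L) T⟩) =
      some ⟨some (.inr true), (v, none), auxStk (update S k₁ z) (L.reverse ++ T)⟩ := by
  intro L
  induction L with
  | nil =>
    intro T o
    simp only [List.length_nil, iterate_bind_succ, Function.iterate_zero, id_eq, step, postProcess,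
      stepAux]
    simp only [auxStk, update_self, List.head?_nil, Option.isSome_none, cond_false]
    rw [stepAux_pushList]
    simp only [stepAux, update_auxStk_inl]
    simp [auxStk]
  | cons a L ih =>
    intro T o
    rw [List.length_cons, iterate_bind_succ]
    simp only [step, postProcess, stepAux]
    simp only [auxStk, update_self, List.head?_cons, Option.isSome_some, cond_true, List.tail_cons,
      Option.getD_some, update_auxStk_inl, update_auxStk_inr, update_idem]
    rw [ih]
    simp

/-- The second move undoes the reversal: symbols arrive last first, each in front of what is already
there, so the substituted words end up in the original order. -/
theorem iterate_step_emit (v : σ) (S : ∀ k, List (Γ k)) : ∀ (T L : List (Γ k₁))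
    (o : Option (Γ k₁)),
      (flip bind (step (postProcess m a₀ w z)))^[T.length + 1]
        (some ⟨some (.inr true), (v, o), auxStk (update S k₁ L) T⟩) =
      some ⟨none, (v, none), auxStk (update S k₁
        (T.reverse.flatMap (fun a => if a = a₀ then w else [a]) ++ L)) []⟩ := by
  intro T
  induction T with
  | nil =>
    intro L o
    simp only [List.length_nil, iterate_bind_succ, Function.iterate_zero, id_eq, step, postProcess,
      stepAux]
    simp only [auxStk, List.head?_nil, Option.isSome_none, cond_false, update_auxStk_inr]
    simp
  | cons a T ih =>
    intro L o
    rw [List.length_cons, iterate_bind_succ]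
    simp only [step, postProcess, stepAux]
    simp only [auxStk, List.head?_cons, Option.isSome_some, cond_true, List.tail_cons,
      Option.getD_some, Option.elim_some, update_auxStk_inr]
    by_cases ha : a = a₀
    · subst ha
      simp only [decide_true, cond_true]
      rw [stepAux_pushList]
      simp only [stepAux, update_auxStk_inl]
      simp only [auxStk, update_self, update_idem]
      rw [ih]
      simp
    · simp only [decide_eq_false ha, cond_false, update_auxStk_inl]
      simp only [update_self, update_idem]
      rw [ih]
      simp [ha]

theorem iterate_step_postProcess_halt (v : σ) (S : ∀ k, List (Γ k)) (L : List (Γ k₁)) (n : ℕ)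
    (a : Cfg Γ Λ σ) (h : (flip bind (step m))^[n] (some a) = some ⟨none, v, update S k₁ L⟩) :
    (flip bind (step (postProcess m a₀ w z)))^[(L.length + 1) + ((L.length + 1) + n)]
        (some (auxCfg none [] a)) =
      some ⟨none, (v, none), auxStk (update S k₁
        (L.flatMap (fun a => if a = a₀ then w else [a]) ++ z)) []⟩ := by
  have h1 := iterate_step_postProcess m a₀ w z none [] n _ _ h
  have h2 := iterate_step_collect m a₀ w z v S L [] none
  have h3 := iterate_step_emit m a₀ w z v S L.reverse z none
  rw [List.length_reverse, List.reverse_reverse] at h3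
  rw [List.append_nil] at h2
  rw [Function.iterate_add_apply _ (L.length + 1), Function.iterate_add_apply _ (L.length + 1), h1,
    ← h3, ← h2]
  rfl

end

end Turing.TM2

/-! ### Closure of polynomial time under substitution and appending -/

namespace Turing

open TM2

/-- The machine `tm`, followed by post-processing of its output. -/
def FinTM2.postProcess (tm : FinTM2) [DecidableEq (tm.Γ tm.k₁)] [Fintype (tm.Γ tm.k₁)]
    (a₀ : tm.Γ tm.k₁) (w z : List (tm.Γ tm.k₁)) : FinTM2 :=
  letI := tm.kFin
  letI := tm.ΛFin
  letI := tm.σFin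
  letI := tm.Γk₀Fin
  { K := tm.K ⊕ Unit
    k₀ := .inl tm.k₀
    k₁ := .inl tm.k₁
    Γ := auxAlphabet tm.Γ tm.k₁
    Λ := tm.Λ ⊕ Bool
    main := .inl tm.main
    σ := tm.σ × Option (tm.Γ tm.k₁)
    initialState := (tm.initialState, none)
    Γk₀Fin := tm.Γk₀Fin
    m := TM2.postProcess tm.m a₀ w z }

theorem initList_stk (tm : FinTM2) (s : List (tm.Γ tm.k₀)) :
    (initList tm s).stk = Function.update (fun _ => []) tm.k₀ s := by
  funext k
  by_cases h : k = tm.k₀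
  · subst h; simp [initList]
  · simp [initList, h]

theorem haltList_stk (tm : FinTM2) (s : List (tm.Γ tm.k₁)) :
    (haltList tm s).stk = Function.update (fun _ => []) tm.k₁ s := by
  funext k
  by_cases h : k = tm.k₁
  · subst h; simp [haltList]
  · simp [haltList, h]

/-- If `f` is computable in polynomial time, then so is the function whose output is obtained from
the output of `f` by replacing a symbol by a word everywhere and appending a word. -/
theorem TM2ComputableInPolyTime.subst_append {α β γ αΓ βΓ : Type} [Finite βΓ] [DecidableEq βΓ]
    {ea : α → List αΓ} {eb : β → List βΓ} {ec : γ → List βΓ} {f : α → β} {g : α → γ}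
    (h : TM2ComputableInPolyTime ea eb f) (a₀ : βΓ) (w z : List βΓ)
    (hg : ∀ a, ec (g a) = (eb (f a)).flatMap (fun s => if s = a₀ then w else [s]) ++ z) :
    Nonempty (TM2ComputableInPolyTime ea ec g) := by
  classical
  obtain ⟨⟨tm, ein, eout⟩, time, hout⟩ := h
  have : Finite (tm.Γ tm.k₁) := Finite.of_equiv _ eout.symm
  let _ : Fintype (tm.Γ tm.k₁) := Fintype.ofFinite _
  let _ := tm.ΛFin
  obtain ⟨N, hN⟩ : ∃ N, ∀ l, pushCount (tm.m l) ≤ N :=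
    ⟨Finset.univ.sup fun l => pushCount (tm.m l),
      fun l => Finset.le_sup (f := fun l => pushCount (tm.m l)) (Finset.mem_univ l)⟩
  refine ⟨⟨⟨tm.postProcess (eout.symm a₀) (w.map eout.symm) (z.map eout.symm), ein, eout⟩,
    -- Each of the two moves takes one step more than the length of the output, which is at most the
    -- input length plus `N` times the running time.
    time + 2 * (Polynomial.X + Polynomial.C N * time + 1), fun a => ?_⟩⟩
  obtain ⟨⟨n, hn⟩, hle⟩ := hout a
  set out := (eb (f a)).map eout.symm with hout_def
  set tm' := tm.postProcess (eout.symm a₀) (w.map eout.symm) (z.map eout.symm)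
  have hlen : out.length ≤ (ea a).length + n * N := by
    have := length_iterate_step_le tm.k₁ tm.m N hN n _ _ hn
    rw [haltList_stk, initList_stk] at this
    simp only [Function.update_self] at this
    refine this.trans (Nat.add_le_add_right ?_ _)
    -- Input and output stack may coincide; the output stack then starts with the input on it,
    -- whence the summand `(ea a).length`.
    by_cases hk : tm.k₁ = tm.k₀
    · rw [hk]; simp
    · rw [Function.update_of_ne hk]; simp
  have hstart : initList tm' ((ea a).map ein.symm) =
      auxCfg none [] (initList tm ((ea a).map ein.symm)) := by
    have hs := initList_stk tm' ((ea a).map ein.symm)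
    have h2 := initList_stk tm ((ea a).map ein.symm)
    have : (initList tm' ((ea a).map ein.symm)).stk =
        auxStk (initList tm ((ea a).map ein.symm)).stk [] := by
      rw [hs, h2, ← update_auxStk_inl]
      congr 1
      funext k
      rcases k with k | k <;> rfl
    exact congrArg (TM2.Cfg.mk _ _) this
  have hend : haltList tm' ((ec (g a)).map eout.symm) =
      ⟨none, (tm.initialState, none), auxStk (Function.update (fun _ => []) tm.k₁
        ((ec (g a)).map eout.symm)) []⟩ := by
    have hs := haltList_stk tm' ((ec (g a)).map eout.symm)
    have : (haltList tm' ((ec (g a)).map eout.symm)).stk =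
        auxStk (Function.update (fun _ => []) tm.k₁ ((ec (g a)).map eout.symm)) [] := by
      rw [hs, ← update_auxStk_inl]
      congr 1
      funext k
      rcases k with k | k <;> rfl
    exact congrArg (TM2.Cfg.mk _ _) this
  have hword : (ec (g a)).map eout.symm = out.flatMap
      (fun s => if s = eout.symm a₀ then w.map eout.symm else [s]) ++ z.map eout.symm := by
    rw [hg, List.map_append, hout_def, List.map_flatMap, List.flatMap_map]
    congr 2
    funext s
    by_cases hs : s = a₀ <;> simp [hs]
  have hn' : (flip bind (TM2.step tm.m))^[n] (some (initList tm ((ea a).map ein.symm))) =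
      some ⟨none, tm.initialState, Function.update (fun _ => []) tm.k₁ out⟩ := by
    rw [← haltList_stk]; exact hn
  have h4 := iterate_step_postProcess_halt tm.m (eout.symm a₀) (w.map eout.symm)
    (z.map eout.symm) _ _ _ _ _ hn'
  rw [← hword] at h4
  refine ⟨⟨(out.length + 1) + ((out.length + 1) + n),
    (congrArg (fun c => (flip bind (TM2.step _))^[_] (some c)) hstart).trans
      (h4.trans (congrArg some hend.symm))⟩, ?_⟩
  · simp only [Polynomial.eval_add, Polynomial.eval_mul,
      Polynomial.eval_X, Polynomial.eval_C, Polynomial.eval_one, Polynomial.eval_ofNat]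
    have : n * N ≤ N * time.eval (ea a).length := by
      rw [mul_comm]; exact Nat.mul_le_mul_left _ hle
    simp only at hle
    linarith

end Turing

/-- The post-processing machine keeps an output symbol in its internal memory, which must be finite.
-/
instance : Finite CircuitSym := by
  refine Finite.of_surjective (α := Fin 8 ⊕ Reg) (fun
    | .inl i => ![.H, .T, .X, .CNOT, .measure, .reset, .query, .tick] i
    | .inr r => .reg r) ?_
  rintro (_ | _ | _ | _ | _ | _ | _ | r | _)
  exacts [⟨.inl 0, rfl⟩, ⟨.inl 1, rfl⟩, ⟨.inl 2, rfl⟩, ⟨.inl 3, rfl⟩, ⟨.inl 4, rfl⟩,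
    ⟨.inl 5, rfl⟩, ⟨.inl 6, rfl⟩, ⟨.inr r, rfl⟩, ⟨.inl 7, rfl⟩]

/-! ## Unitarity of circuits -/

section Unitarity

variable {sz : Reg → ℕ}

theorem setBit_apply_self (x : Basis sz) (r : Reg) (i : Fin (sz r)) (b : Bool) :
    setBit x r i b r i = b := by
  simp [setBit]

theorem setBit_apply_of_ne (x : Basis sz) (r : Reg) (i : Fin (sz r)) (b : Bool) (r' : Reg)
    (j : Fin (sz r')) (h : (r, (i : ℕ)) ≠ (r', (j : ℕ))) : setBit x r i b r' j = x r' j := by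
  by_cases hr : r' = r
  · subst hr
    have : j ≠ i := fun hj => h (by rw [hj])
    simp [setBit, this]
  · simp [setBit, hr]

theorem setBit_setBit (x : Basis sz) (r : Reg) (i : Fin (sz r)) (b c : Bool) :
    setBit (setBit x r i b) r i c = setBit x r i c := by
  simp [setBit]

theorem setBit_self (x : Basis sz) (r : Reg) (i : Fin (sz r)) : setBit x r i (x r i) = x := by
  simp [setBit]

theorem flip_involutive (r : Reg) (i : Fin (sz r)) :
    Function.Involutive fun y : Basis sz => setBit y r i (!(y r i)) := by
  intro y
  simp only [setBit_apply_self, setBit_setBit, Bool.not_not, setBit_self]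

theorem cnot_involutive (r : Reg) (i : Fin (sz r)) (r' : Reg) (j : Fin (sz r'))
    (h : (r, (i : ℕ)) ≠ (r', (j : ℕ))) :
    Function.Involutive fun y : Basis sz => setBit y r' j (xor (y r' j) (y r i)) := by
  intro y
  simp only [setBit_apply_self, setBit_setBit, setBit_apply_of_ne _ _ _ _ _ _ h.symm,
    Bool.xor_assoc, Bool.xor_self, Bool.xor_false, setBit_self]

theorem basisMapOp_conj_diagonal {f : Basis sz → Basis sz} (hf : Function.Injective f)
    (d : Basis sz → ℂ) :
    (basisMapOp f)ᴴ * Matrix.diagonal d * basisMapOp f = Matrix.diagonal fun x => d (f x) := by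
  ext x y
  rw [Matrix.mul_apply]
  simp only [Matrix.mul_diagonal, Matrix.conjTranspose_apply, basisMapOp, Matrix.of_apply]
  rw [Finset.sum_eq_single (f x)]
  · by_cases hxy : x = y
    · subst hxy; simp
    · simp [hxy, hf.eq_iff]
  · intro z _ hz; simp [hz]
  · simp

theorem basisMapOp_conjTranspose_mul_self {f : Basis sz → Basis sz} (hf : Function.Injective f) :
    (basisMapOp f)ᴴ * basisMapOp f = 1 := by
  simpa using basisMapOp_conj_diagonal hf fun _ => 1

/-- Writing `H = (X + Z)/√2` reduces unitarity to `X² = Z² = 1` and `XZ + ZX = 0`, with no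
computation of matrix entries of `H†H`. -/
theorem hadamardOp_eq (r : Reg) (i : Fin (sz r)) :
    hadamardOp r i = ((Real.sqrt 2 : ℂ)⁻¹) •
      (xOp r i + Matrix.diagonal fun x : Basis sz => if x r i then -1 else 1) := by
  ext x y
  simp only [hadamardOp, xOp, basisMapOp, Matrix.smul_apply, Matrix.add_apply, Matrix.of_apply,
    Matrix.diagonal_apply, smul_eq_mul]
  by_cases hxy : x = y
  · subst hxy
    have h1 : ¬ x = setBit x r i (!(x r i)) := fun h => by
      have := congrFun (congrFun h r) i
      rw [setBit_apply_self] at this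
      cases hb : x r i <;> simp [hb] at this
    rw [if_pos (setBit_self x r i).symm, if_neg h1]
    cases x r i <;> simp [div_eq_mul_inv]
  · by_cases hb : x r i = y r i
    · have h1 : ¬ x = setBit y r i (x r i) := by rwa [hb, setBit_self]
      have h2 : ¬ x = setBit y r i (!(y r i)) := fun h => by
        have := congrFun (congrFun h r) i
        rw [setBit_apply_self, hb] at this
        cases hb : y r i <;> simp [hb] at this
      rw [if_neg h1, if_neg h2]; simp [hxy]
    · have h1 : (!(y r i)) = x r i := by cases hx : x r i <;> cases hy : y r i <;> simp_all
      simp only [h1]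
      have h2 : ¬ (x r i = true ∧ y r i = true) := fun h => hb (h.1.trans h.2.symm)
      simp [hxy, h2, div_eq_mul_inv]

theorem xOp_conjTranspose (r : Reg) (i : Fin (sz r)) : (xOp r i : Op sz)ᴴ = xOp r i := by
  ext x y
  simp only [xOp, basisMapOp, Matrix.conjTranspose_apply, Matrix.of_apply]
  have : y = setBit x r i (!(x r i)) ↔ x = setBit y r i (!(y r i)) :=
    ⟨fun h => ((flip_involutive r i).eq_iff.mp h.symm),
      fun h => ((flip_involutive r i).eq_iff.mp h.symm)⟩
  simp [this]

theorem xOp_conjTranspose_mul_self (r : Reg) (i : Fin (sz r)) :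
    (xOp r i : Op sz)ᴴ * xOp r i = 1 :=
  basisMapOp_conjTranspose_mul_self (flip_involutive r i).injective

theorem hadamardOp_conjTranspose_mul_self (r : Reg) (i : Fin (sz r)) :
    (hadamardOp r i : Op sz)ᴴ * hadamardOp r i = 1 := by
  set Z : Op sz := Matrix.diagonal fun x => if x r i then -1 else 1 with hZ
  have hZH : Zᴴ = Z := by
    rw [hZ, Matrix.diagonal_conjTranspose]
    congr 1; funext x
    by_cases h : x r i <;> simp [h]
  have hZZ : Z * Z = 1 := by
    rw [hZ, Matrix.diagonal_mul_diagonal, ← Matrix.diagonal_one]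
    congr 1; funext x
    by_cases h : x r i <;> simp [h]
  have hXX : (xOp r i : Op sz) * xOp r i = 1 := by
    have := xOp_conjTranspose_mul_self (sz := sz) r i
    rwa [xOp_conjTranspose] at this
  have hXZ : (xOp r i : Op sz) * Z + Z * xOp r i = 0 := by
    ext x y
    rw [Matrix.add_apply, hZ, Matrix.mul_diagonal, Matrix.diagonal_mul]
    simp only [xOp, basisMapOp, Matrix.of_apply, Matrix.zero_apply]
    by_cases h : x = setBit y r i (!(y r i))
    · have : x r i = !(y r i) := by rw [h, setBit_apply_self]
      rw [this, if_pos h]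
      cases y r i <;> simp
    · simp [h]
  have h2 : star ((Real.sqrt 2 : ℂ)⁻¹) * (Real.sqrt 2 : ℂ)⁻¹ * 2 = 1 := by
    have : ((Real.sqrt 2 : ℝ) : ℂ) * (Real.sqrt 2 : ℝ) = 2 := by
      rw [← Complex.ofReal_mul, Real.mul_self_sqrt (by norm_num)]; norm_num
    have h0 : ((Real.sqrt 2 : ℝ) : ℂ) ≠ 0 := by simp
    rw [star_inv₀, Complex.star_def, Complex.conj_ofReal]
    field_simp
    rw [pow_two, this]
  rw [hadamardOp_eq, ← hZ, Matrix.conjTranspose_smul, Matrix.conjTranspose_add, hZH,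
    xOp_conjTranspose, smul_mul_smul_comm, add_mul, mul_add, mul_add, hXX, hZZ]
  have : (1 : Op sz) + xOp r i * Z + (Z * xOp r i + 1) = (2 : ℂ) • (1 : Op sz) := by
    rw [two_smul, add_assoc, ← add_assoc (xOp r i * Z), hXZ, zero_add]
  rw [this, smul_smul, h2, one_smul]

theorem gateOp_conjTranspose_mul_self (g : Gate) : (gateOp sz g)ᴴ * gateOp sz g = 1 := by
  rcases g with ⟨r, i⟩ | ⟨r, i⟩ | ⟨r, i⟩ | ⟨⟨r, i⟩, ⟨r', j⟩⟩ <;> simp only [gateOp] <;>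
    split_ifs with h <;> try simp only [Matrix.conjTranspose_one, mul_one]
  · exact hadamardOp_conjTranspose_mul_self _ _
  · rw [tOp, Matrix.diagonal_conjTranspose, Matrix.diagonal_mul_diagonal, ← Matrix.diagonal_one]
    congr 1; funext x
    by_cases hx : x r ⟨i, h⟩
    · have hc : (starRingEnd ℂ) (Complex.I * Real.pi / 4) = -(Complex.I * Real.pi / 4) := by
        rw [map_div₀, map_mul, Complex.conj_I, Complex.conj_ofReal, map_ofNat, neg_mul, neg_div]
      simp only [hx, if_true, Pi.star_apply, Complex.star_def, ← Complex.exp_conj,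
        ← Complex.exp_add, hc, neg_add_cancel, Complex.exp_zero]
    · simp [hx]
  · exact xOp_conjTranspose_mul_self _ _
  · exact basisMapOp_conjTranspose_mul_self (cnot_involutive _ _ _ _ h.2).injective

theorem conjTranspose_mul_mul_self {U V : Op sz} (hU : Uᴴ * U = 1) (hV : Vᴴ * V = 1) :
    (U * V)ᴴ * (U * V) = 1 := by
  rw [Matrix.conjTranspose_mul, Matrix.mul_assoc, ← Matrix.mul_assoc Uᴴ, hU, Matrix.one_mul, hV]

theorem circuitOp_conjTranspose_mul_self (c : List Gate) :
    (circuitOp sz c)ᴴ * circuitOp sz c = 1 := by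
  induction c with
  | nil => simp [circuitOp]
  | cons g c ih => exact conjTranspose_mul_mul_self ih (gateOp_conjTranspose_mul_self g)

theorem circuitOp_append (c d : List Gate) :
    circuitOp sz (c ++ d) = circuitOp sz d * circuitOp sz c := by
  induction c with
  | nil => simp [circuitOp]
  | cons g c ih => simp only [List.cons_append, circuitOp, ih, Matrix.mul_assoc]

theorem writeOp_conjTranspose_mul_self (r : Reg) (s : Bits (sz r)) :
    (writeOp r s : Op sz)ᴴ * writeOp r s = 1 := by
  apply basisMapOp_conjTranspose_mul_self
  apply Function.Involutive.injective
  intro y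
  simp

end Unitarity

/-! ## Positivity and trace -/

section Channels

open scoped ComplexOrder

variable {sz : Reg → ℕ}

/-- Additive maps on operators that preserve positivity and the trace. -/
structure IsChannel (Φ : Op sz → Op sz) : Prop where
  map_add : ∀ ρ σ, Φ (ρ + σ) = Φ ρ + Φ σ
  posSemidef : ∀ ρ, ρ.PosSemidef → (Φ ρ).PosSemidef
  trace_eq : ∀ ρ, (Φ ρ).trace = ρ.trace

theorem IsChannel.map_sub {Φ : Op sz → Op sz} (h : IsChannel Φ) (ρ σ : Op sz) :
    Φ (ρ - σ) = Φ ρ - Φ σ := by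
  rw [eq_sub_iff_add_eq, ← h.map_add, sub_add_cancel]

theorem IsChannel.comp {Φ Ψ : Op sz → Op sz} (h : IsChannel Φ) (h' : IsChannel Ψ) :
    IsChannel fun ρ => Φ (Ψ ρ) where
  map_add ρ σ := by rw [h'.map_add, h.map_add]
  posSemidef ρ hρ := h.posSemidef _ (h'.posSemidef _ hρ)
  trace_eq ρ := by rw [h.trace_eq, h'.trace_eq]

theorem isChannel_id : IsChannel (id : Op sz → Op sz) :=
  ⟨fun _ _ => rfl, fun _ h => h, fun _ => rfl⟩

theorem isChannel_conj {U : Op sz} (hU : Uᴴ * U = 1) : IsChannel fun ρ => U * ρ * Uᴴ where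
  map_add ρ σ := by rw [mul_add, add_mul]
  posSemidef ρ hρ := hρ.mul_mul_conjTranspose_same U
  trace_eq ρ := by rw [Matrix.trace_mul_comm, ← Matrix.mul_assoc, hU, Matrix.one_mul]

theorem isChannel_measureQubit (r : Reg) (i : Fin (sz r)) :
    IsChannel (measureQubit r i : Op sz → Op sz) where
  map_add ρ σ := by
    ext x y
    simp only [measureQubit, Matrix.add_apply, Matrix.of_apply]
    split_ifs <;> simp
  posSemidef ρ hρ := by
    -- Kraus form, with the projections onto the two values of the qubit; positivity is then
    -- immediate.
    have h : measureQubit r i ρ = ∑ b : Bool,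
        (Matrix.diagonal fun x : Basis sz => if x r i = b then (1 : ℂ) else 0) * ρ *
          (Matrix.diagonal fun x : Basis sz => if x r i = b then (1 : ℂ) else 0)ᴴ := by
      ext x y
      rw [Matrix.sum_apply, Fintype.sum_bool]
      simp only [measureQubit, Matrix.of_apply, Matrix.diagonal_conjTranspose,
        Matrix.mul_diagonal, Matrix.diagonal_mul]
      cases x r i <;> cases hy : y r i <;> simp [hy]
    rw [h]
    exact Matrix.posSemidef_sum _ fun b _ => hρ.mul_mul_conjTranspose_same _
  trace_eq ρ := by simp [Matrix.trace, measureQubit]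

/-- A basis state is a content of `r` together with a state in which `r` is cleared. This is why the
partial trace preserves the trace. -/
theorem sum_update_eq_sum {M : Type} [AddCommMonoid M] (r : Reg) (f : Basis sz → M) :
    (∑ x : Basis sz, if x r = (fun _ => false) then
      ∑ s : Bits (sz r), f (Function.update x r s) else 0) = ∑ z, f z := by
  rw [← Finset.sum_filter, ← Finset.sum_product']
  refine Finset.sum_nbij' (fun p => Function.update p.1 r p.2)
    (fun z => (Function.update z r fun _ => false, z r)) ?_ ?_ ?_ ?_ ?_
  · simp
  · simp
  · rintro ⟨x, s⟩ h
    have hx : x r = fun _ => false := by simpa using h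
    simp [← hx]
  · simp
  · simp

theorem isChannel_resetReg (r : Reg) : IsChannel (resetReg r : Op sz → Op sz) where
  map_add ρ σ := by
    ext x y
    simp only [resetReg, Matrix.add_apply, Matrix.of_apply]
    split_ifs <;> simp [Finset.sum_add_distrib]
  posSemidef ρ hρ := by
    -- Kraus form, with the operators `|0…0⟩⟨s|` on the register `r`.
    have h : resetReg r ρ = ∑ s : Bits (sz r),
        (Matrix.of fun x y : Basis sz => if x r = (fun _ => false) ∧ y = Function.update x r s
          then (1 : ℂ) else 0) * ρ *
        (Matrix.of fun x y : Basis sz => if x r = (fun _ => false) ∧ y = Function.update x r s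
          then (1 : ℂ) else 0)ᴴ := by
      ext x y
      rw [Matrix.sum_apply]
      simp only [resetReg, Matrix.of_apply, Matrix.mul_apply, Matrix.conjTranspose_apply]
      by_cases hx : x r = fun _ => false
      · by_cases hy : y r = fun _ => false
        · simp [hx, hy]
        · simp [hy]
      · simp [hx]
    rw [h]
    exact Matrix.posSemidef_sum _ fun s _ => hρ.mul_mul_conjTranspose_same _
  trace_eq ρ := by
    simp only [Matrix.trace, resetReg, Matrix.diag_apply, Matrix.of_apply, and_self]
    exact sum_update_eq_sum r fun z => ρ z z

theorem isChannel_runInstr {O : Op sz → Op sz} (hO : IsChannel O) (i : Instr) :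
    IsChannel (runInstr O i) := by
  rcases i with g | ⟨r, i⟩ | r | _
  · exact isChannel_conj (gateOp_conjTranspose_mul_self g)
  · by_cases h : i < sz r
    · have : runInstr O (.measure (r, i)) = measureQubit r ⟨i, h⟩ := by
        funext ρ; simp [runInstr, h]
      rw [this]; exact isChannel_measureQubit _ _
    · have : runInstr O (.measure (r, i)) = id := by
        funext ρ; simp [runInstr, h]
      rw [this]; exact isChannel_id
  · exact isChannel_resetReg r
  · exact hO

theorem isChannel_runCircuit {O : Op sz → Op sz} (hO : IsChannel O) (c : List Instr) :
    IsChannel (runCircuit O c) := by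
  induction c with
  | nil => exact isChannel_id
  | cons i c ih => exact ih.comp (isChannel_runInstr hO i)

/-! ### The verification oracle -/

theorem verifyProj_conjTranspose (χ : Bits (sz .dk) → ℂ) : (verifyProj χ)ᴴ = verifyProj χ := by
  ext x y
  simp only [verifyProj, Matrix.conjTranspose_apply, Matrix.of_apply]
  have : y = Function.update x .dk (y .dk) ↔ x = Function.update y .dk (x .dk) := by
    constructor <;> intro h <;> rw [h] <;> simp
  simp only [this]
  split_ifs <;> simp [mul_comm]

theorem sum_update_dk {M : Type} [AddCommMonoid M] (x : Basis sz) (f : Basis sz → M) :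
    (∑ z, if z = Function.update x .dk (z .dk) then f z else 0) =
      ∑ s, f (Function.update x .dk s) := by
  rw [← Finset.sum_filter]
  refine Finset.sum_nbij' (fun z => z .dk) (fun s => Function.update x .dk s) ?_ ?_ ?_ ?_ ?_
  · simp
  · simp
  · intro z hz; simpa using ((Finset.mem_filter.mp hz).2).symm
  · simp
  · intro z hz; rw [← (Finset.mem_filter.mp hz).2]

theorem verifyProj_mul_apply (χ : Bits (sz .dk) → ℂ) (ρ : Op sz) (x y : Basis sz) :
    (verifyProj χ * ρ) x y =
      ∑ s, χ (x .dk) * star (χ s) * ρ (Function.update x .dk s) y := by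
  have h := sum_update_dk x fun z => χ (x .dk) * star (χ (z .dk)) * ρ z y
  simp only [Function.update_self] at h
  rw [← h, Matrix.mul_apply]
  refine Finset.sum_congr rfl fun z _ => ?_
  have : x = Function.update z .dk (x .dk) ↔ z = Function.update x .dk (z .dk) := by
    constructor <;> intro h <;> rw [h] <;> simp
  simp only [verifyProj, Matrix.of_apply, this]
  split_ifs <;> simp

theorem mul_verifyProj_apply (χ : Bits (sz .dk) → ℂ) (ρ : Op sz) (x y : Basis sz) :
    (ρ * verifyProj χ) x y =
      ∑ s, ρ x (Function.update y .dk s) * (χ s * star (χ (y .dk))) := by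
  have h := sum_update_dk y fun z => ρ x z * (χ (z .dk) * star (χ (y .dk)))
  simp only [Function.update_self] at h
  rw [← h, Matrix.mul_apply]
  refine Finset.sum_congr rfl fun z _ => ?_
  simp only [verifyProj, Matrix.of_apply]
  split_ifs <;> simp

theorem verifyProj_mul_self {χ : Bits (sz .dk) → ℂ} (hχ : ∑ s, star (χ s) * χ s = 1) :
    verifyProj χ * verifyProj χ = verifyProj χ := by
  ext x y
  rw [verifyProj_mul_apply]
  simp only [verifyProj, Matrix.of_apply, Function.update_self]
  have h (s) : Function.update x .dk s = Function.update y .dk s ↔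
      x = Function.update y .dk (x .dk) := by
    constructor
    · intro h
      have := congrArg (fun z => Function.update z .dk (x .dk)) h
      simpa using this
    · intro h; rw [h]; simp
  simp only [h]
  split_ifs
  · rw [← mul_one (χ (x .dk) * _), ← hχ, Finset.mul_sum]
    exact Finset.sum_congr rfl fun s _ => by ring
  · simp

/-- Cyclicity of the partial trace, valid because `verifyProj χ` acts on the traced-out register
only. -/
theorem resetReg_dk_mul_verifyProj (χ : Bits (sz .dk) → ℂ) (ρ : Op sz) :
    resetReg .dk (ρ * verifyProj χ) = resetReg .dk (verifyProj χ * ρ) := by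
  ext x y
  simp only [resetReg, Matrix.of_apply, verifyProj_mul_apply, mul_verifyProj_apply,
    Function.update_self, Function.update_idem]
  split_ifs
  · rw [Finset.sum_comm]
    exact Finset.sum_congr rfl fun s _ => Finset.sum_congr rfl fun t _ => by ring
  · rfl

/-- Measuring a register before it is discarded makes no difference. -/
theorem resetReg_dk_verifyProj {χ : Bits (sz .dk) → ℂ} (hχ : ∑ s, star (χ s) * χ s = 1)
    (ρ : Op sz) :
    resetReg .dk ((1 - verifyProj χ) * ρ * (1 - verifyProj χ)) +
      resetReg .dk (verifyProj χ * ρ * verifyProj χ) = resetReg .dk ρ := by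
  have h := isChannel_resetReg (sz := sz) .dk
  have h1 : resetReg .dk (verifyProj χ * ρ * verifyProj χ) = resetReg .dk (verifyProj χ * ρ) := by
    rw [resetReg_dk_mul_verifyProj, ← Matrix.mul_assoc, verifyProj_mul_self hχ]
  have h2 : (1 - verifyProj χ) * ρ * (1 - verifyProj χ) =
      ρ - verifyProj χ * ρ - (ρ * verifyProj χ - verifyProj χ * ρ * verifyProj χ) := by
    noncomm_ring
  rw [h2, h.map_sub, h.map_sub, h.map_sub, h1, resetReg_dk_mul_verifyProj]
  abel

theorem isChannel_verifyOracle {χ : Bits (sz .dk) → ℂ} (hχ : ∑ s, star (χ s) * χ s = 1) :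
    IsChannel (verifyOracle χ) := by
  have hR : IsChannel fun ρ : Op sz => resetReg .ans (resetReg .dk ρ) :=
    (isChannel_resetReg .ans).comp (isChannel_resetReg .dk)
  have hX := isChannel_conj (gateOp_conjTranspose_mul_self (sz := sz) (.X (.ans, 0)))
  have hX' := hX.comp hR
  have hP := verifyProj_conjTranspose χ
  have hQ : (1 - verifyProj χ)ᴴ = 1 - verifyProj χ := by
    rw [Matrix.conjTranspose_sub, Matrix.conjTranspose_one, hP]
  refine ⟨fun ρ σ => ?_, fun ρ hρ => ?_, fun ρ => ?_⟩
  · have e1 := hR.map_add ((1 - verifyProj χ) * ρ * (1 - verifyProj χ))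
      ((1 - verifyProj χ) * σ * (1 - verifyProj χ))
    have e2 := hX'.map_add (verifyProj χ * ρ * verifyProj χ) (verifyProj χ * σ * verifyProj χ)
    simp only [verifyOracle, mul_add _ ρ σ, add_mul _ _ (verifyProj χ),
      add_mul _ _ (1 - verifyProj χ)] at e1 e2 ⊢
    rw [e1, e2]
    abel
  · refine (hR.posSemidef _ ?_).add (hX'.posSemidef _ ?_)
    · have := hρ.mul_mul_conjTranspose_same (1 - verifyProj χ)
      rwa [hQ] at this
    · have := hρ.mul_mul_conjTranspose_same (verifyProj χ)
      rwa [hP] at this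
  · have h := congrArg Matrix.trace (resetReg_dk_verifyProj hχ ρ)
    rw [Matrix.trace_add, (isChannel_resetReg .dk).trace_eq ρ] at h
    simp only [verifyOracle]
    rw [Matrix.trace_add, hX.trace_eq, (isChannel_resetReg .ans).trace_eq,
      (isChannel_resetReg .ans).trace_eq, h]

/-- The verification oracle is dominated by the sum of the two oracles that discard the key register
and give a fixed answer. -/
theorem posSemidef_guess_sub_verifyOracle {χ : Bits (sz .dk) → ℂ}
    (hχ : ∑ s, star (χ s) * χ s = 1) {ρ : Op sz} (hρ : ρ.PosSemidef) :
    (resetReg .ans (resetReg .dk ρ) +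
      gateOp sz (.X (.ans, 0)) * resetReg .ans (resetReg .dk ρ) * (gateOp sz (.X (.ans, 0)))ᴴ -
        verifyOracle χ ρ).PosSemidef := by
  have hR : IsChannel fun ρ : Op sz => resetReg .ans (resetReg .dk ρ) :=
    (isChannel_resetReg .ans).comp (isChannel_resetReg .dk)
  have hX := isChannel_conj (gateOp_conjTranspose_mul_self (sz := sz) (.X (.ans, 0)))
  have hP := verifyProj_conjTranspose χ
  have hQ : (1 - verifyProj χ)ᴴ = 1 - verifyProj χ := by
    rw [Matrix.conjTranspose_sub, Matrix.conjTranspose_one, hP]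
  have h1 := hρ.mul_mul_conjTranspose_same (verifyProj χ)
  have h2 := hρ.mul_mul_conjTranspose_same (1 - verifyProj χ)
  rw [hP] at h1
  rw [hQ] at h2
  -- The excess consists of the two wrong guesses: answer `0` on the accepted part and answer `1` on
  -- the rejected part.
  have key := (hR.posSemidef _ h1).add (hX.posSemidef _ (hR.posSemidef _ h2))
  convert key using 1
  rw [← resetReg_dk_verifyProj hχ ρ, (isChannel_resetReg .ans).map_add]
  simp only [verifyOracle]
  rw [mul_add, add_mul]
  abel

/-! ### Guessing the answer of the oracle -/

/-- Replace the oracle calls of a circuit by the circuit `L`. -/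
def replaceQuery (L : List Instr) (c : List Instr) : List Instr :=
  c.flatMap fun i => match i with
    | .query => L
    | i => [i]

/-- The replacement of an oracle call by the constant answer `v`. -/
def constantAnswer (v : Bool) : List Instr :=
  [.reset .dk, .reset .ans] ++ if v then [.gate (.X (.ans, 0))] else []

theorem replaceQuery_of_not_mem (L c : List Instr) (h : Instr.query ∉ c) :
    replaceQuery L c = c := by
  induction c with
  | nil => rfl
  | cons i c ih =>
    rw [List.mem_cons, not_or] at h
    have := ih h.2
    rcases i with g | w | r | _
    · exact congrArg (_ :: ·) this
    · exact congrArg (_ :: ·) this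
    · exact congrArg (_ :: ·) this
    · exact absurd rfl h.1

theorem query_not_mem_replaceQuery (v : Bool) (c : List Instr) :
    Instr.query ∉ replaceQuery (constantAnswer v) c := by
  simp only [replaceQuery, List.mem_flatMap, not_exists, not_and]
  rintro (g | w | r | _) _ <;> cases v <;> simp [constantAnswer]

theorem runCircuit_append (O : Op sz → Op sz) (c d : List Instr) (ρ : Op sz) :
    runCircuit O (c ++ d) ρ = runCircuit O d (runCircuit O c ρ) := by
  induction c generalizing ρ with
  | nil => rfl
  | cons i c ih => exact ih _

theorem runCircuit_of_not_mem (O O' : Op sz → Op sz) (c : List Instr) (h : Instr.query ∉ c)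
    (ρ : Op sz) : runCircuit O c ρ = runCircuit O' c ρ := by
  induction c generalizing ρ with
  | nil => rfl
  | cons i c ih =>
    rw [List.mem_cons, not_or] at h
    have : runInstr O i ρ = runInstr O' i ρ := by
      rcases i with g | w | r | _
      · rfl
      · rfl
      · rfl
      · exact absurd rfl h.1
    simp only [runCircuit, this, ih h.2]

/-- A run with at most one call of the verification oracle is dominated by the sum of the two runs
in which the answer is guessed. -/
theorem posSemidef_guess_sub_runCircuit {χ : Bits (sz .dk) → ℂ}
    (hχ : ∑ s, star (χ s) * χ s = 1) (c : List Instr)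
    (hc : (c.filter fun i => i matches .query).length ≤ 1) :
    ∀ ρ : Op sz, ρ.PosSemidef →
    (runCircuit id (replaceQuery (constantAnswer false) c) ρ +
      runCircuit id (replaceQuery (constantAnswer true) c) ρ -
        runCircuit (verifyOracle χ) c ρ).PosSemidef := by
  induction c with
  | nil => intro ρ hρ; simpa [replaceQuery, runCircuit] using hρ
  | cons i c ih =>
    intro ρ hρ
    by_cases hi : i = .query
    · subst hi
      -- After the only call, the true run and both guessed runs continue with the same channel, so
      -- the inequality for a single call propagates.
      have hq : Instr.query ∉ c := by
        intro h
        have : 0 < (c.filter fun i => i matches .query).length :=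
          List.length_pos_of_mem (List.mem_filter.mpr ⟨h, rfl⟩)
        simp only [List.filter_cons, if_true, List.length_cons] at hc
        omega
      have hrep (v) : replaceQuery (constantAnswer v) (.query :: c) = constantAnswer v ++ c :=
        congrArg (constantAnswer v ++ ·) (replaceQuery_of_not_mem _ c hq)
      have hΦ := isChannel_runCircuit (isChannel_id (sz := sz)) c
      rw [hrep, hrep, runCircuit_append, runCircuit_append, runCircuit,
        runCircuit_of_not_mem (verifyOracle χ) id c hq, ← hΦ.map_add, ← hΦ.map_sub]
      exact hΦ.posSemidef _ (posSemidef_guess_sub_verifyOracle hχ hρ)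
    · have hrep (v) : replaceQuery (constantAnswer v) (i :: c) =
          i :: replaceQuery (constantAnswer v) c := by
        rcases i with g | w | r | _
        · rfl
        · rfl
        · rfl
        · exact absurd rfl hi
      have hrun : runInstr id i ρ = runInstr (verifyOracle χ) i ρ := by
        rcases i with g | w | r | _
        · rfl
        · rfl
        · rfl
        · exact absurd rfl hi
      rw [hrep, hrep, runCircuit, runCircuit, runCircuit, hrun]
      refine ih (le_trans ?_ hc) _
        ((isChannel_runInstr (isChannel_verifyOracle hχ) i).posSemidef _ hρ)
      exact ((List.sublist_cons_self i c).filter _).length_le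

end Channels

/-! ## Averages -/

section Averages

variable {α : Type} [Fintype α]

theorem avg_mono {f g : α → ℝ} (h : ∀ x, f x ≤ g x) : avg f ≤ avg g :=
  div_le_div_of_nonneg_right (Finset.sum_le_sum fun x _ => h x) (Nat.cast_nonneg _)

theorem avg_add (f g : α → ℝ) : (avg fun x => f x + g x) = avg f + avg g := by
  simp only [avg, Finset.sum_add_distrib, add_div]

theorem avg_neg (f : α → ℝ) : (avg fun x => -f x) = -avg f := by
  simp only [avg, Finset.sum_neg_distrib, neg_div]

theorem avg_const [Nonempty α] (c : ℝ) : (avg fun _ : α => c) = c := by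
  simp [avg, mul_div_cancel_left₀]

end Averages

/-! ## Projective implementations -/

section ProjectiveImplementation

open scoped ComplexOrder

variable {ι : Type} [Fintype ι]

/-- For an orthogonal projection, `tr(Eσ) = tr(EσE†)`. -/
theorem re_trace_mul_nonneg {E σ : Matrix ι ι ℂ} (hE : E.IsHermitian) (hEE : E * E = E)
    (hσ : σ.PosSemidef) : 0 ≤ (Matrix.trace (E * σ)).re := by
  have h := (hσ.mul_mul_conjTranspose_same E).trace_nonneg
  rw [hE.eq, Matrix.trace_mul_comm, ← Matrix.mul_assoc, hEE] at h
  exact (Complex.nonneg_iff.mp h).1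

/-- The first outcome of a binary POVM has probability at most `c`, plus the probability that its
projective implementation returns some `p ≥ c`. -/
theorem re_trace_mul_le [DecidableEq ι] {P σ σ₀ σ₁ : Matrix ι ι ℂ} (hP : P.PosSemidef)
    (hP' : (1 - P).PosSemidef)
    (hσ : σ.PosSemidef) (hσ' : (σ₀ + σ₁ - σ).PosSemidef) {c : ℝ} (hc : 0 ≤ c) :
    (Matrix.trace (P * σ)).re ≤ c * (Matrix.trace σ).re +
      (∑ p ∈ (projImpOutcomes P).filter (fun p => c ≤ p),
          (Matrix.trace (projImp P p * σ₀)).re +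
        ∑ p ∈ (projImpOutcomes P).filter (fun p => c ≤ p),
          (Matrix.trace (projImp P p * σ₁)).re) := by
  have h := isProjectiveImplementation_projImp hP hP'
  set E := projImp P
  set O := projImpOutcomes P
  have h1 : (Matrix.trace (P * σ)).re = ∑ p ∈ O, p * (Matrix.trace (E p * σ)).re := by
    conv_lhs => rw [← h.sample_fst]
    rw [Finset.sum_mul, Matrix.trace_sum, Complex.re_sum]
    refine Finset.sum_congr rfl fun p _ => ?_
    rw [Matrix.smul_mul, Matrix.trace_smul, smul_eq_mul, Complex.re_ofReal_mul]
  have h2 : (Matrix.trace σ).re = ∑ p ∈ O, (Matrix.trace (E p * σ)).re := by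
    conv_lhs => rw [← Matrix.one_mul σ, ← h.sum_eq_one]
    rw [Finset.sum_mul, Matrix.trace_sum, Complex.re_sum]
  rw [h1, h2, ← Finset.sum_add_distrib, Finset.sum_filter, Finset.mul_sum,
    ← Finset.sum_add_distrib]
  refine Finset.sum_le_sum fun p hp => ?_
  have ht := re_trace_mul_nonneg (h.hermitian p hp) (h.idempotent p hp) hσ
  have ht' := re_trace_mul_nonneg (h.hermitian p hp) (h.idempotent p hp) hσ'
  rw [mul_sub, mul_add, Matrix.trace_sub, Matrix.trace_add, Complex.sub_re, Complex.add_re] at ht'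
  obtain ⟨_, hp1⟩ := h.mem_unit p hp
  -- For `p ≥ c`, use `p ≤ 1` and the domination of `σ`, dropping the nonnegative term with `c`; for
  -- `p < c`, compare `p` with `c`.
  split_ifs with hcp
  · nlinarith
  · nlinarith

end ProjectiveImplementation

/-! ## Initial states and sent messages -/

section States

open scoped ComplexOrder

variable {sz : Reg → ℕ}

theorem sum_star_leasedKey_mul_self {d : ℕ} (k₀ k₁ : Bits d) :
    ∑ s, star (leasedKey k₀ k₁ s) * leasedKey k₀ k₁ s = 1 := by
  have h2 : ((Real.sqrt 2 : ℝ) : ℂ) * (Real.sqrt 2 : ℝ) = 2 := by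
    rw [← Complex.ofReal_mul, Real.mul_self_sqrt (by norm_num)]; norm_num
  have h3 : star ((1 : ℂ) / (Real.sqrt 2 : ℝ)) * (1 / (Real.sqrt 2 : ℝ)) = 1 / 2 := by
    rw [Complex.star_def, map_div₀, map_one, Complex.conj_ofReal, div_mul_div_comm, h2, one_mul]
  have h (s : Bits (d + 1)) : star (leasedKey k₀ k₁ s) * leasedKey k₀ k₁ s =
      ((if s = Fin.cons (α := fun _ => Bool) false k₀ then 1 else 0) +
        (if s = Fin.cons (α := fun _ => Bool) true k₁ then 1 else 0)) / 2 := by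
    simp only [leasedKey]
    split_ifs with h0 h1
    · have := congrFun (h0.symm.trans h1) 0
      simp at this
    all_goals simp only [add_zero, zero_add, zero_div, star_zero, mul_zero, h3]
  simp only [h, ← Finset.sum_div, Finset.sum_add_distrib, Finset.sum_ite_eq', Finset.mem_univ,
    if_true]
  norm_num

theorem posSemidef_initialState (e₀ : Bits (sz .ek0)) (e₁ : Bits (sz .ek1))
    (χ : Bits (sz .dk) → ℂ) : (initialState e₀ e₁ χ).PosSemidef :=
  Matrix.posSemidef_vecMulVec_self_star _

theorem trace_initialState (e₀ : Bits (sz .ek0)) (e₁ : Bits (sz .ek1)) {χ : Bits (sz .dk) → ℂ}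
    (hχ : ∑ s, star (χ s) * χ s = 1) : (initialState e₀ e₁ χ).trace = 1 := by
  set z : Basis sz := Function.update (Function.update (fun _ _ => false) .ek0 e₀) .ek1 e₁ with hz
  have hcond (x : Basis sz) : (x .ek0 = e₀ ∧ x .ek1 = e₁ ∧
      ∀ r, r ≠ .ek0 → r ≠ .ek1 → r ≠ .dk → x r = (fun _ => false)) ↔
        x = Function.update z .dk (x .dk) := by
    constructor
    · rintro ⟨h0, h1, h2⟩
      funext r
      by_cases hd : r = .dk
      · subst hd; simp
      by_cases h1' : r = .ek1
      · subst h1'; simp [hz, h1]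
      by_cases h0' : r = .ek0
      · subst h0'; simp [hz, h0]
      rw [h2 r h0' h1' hd]
      simp [hz, hd, h1', h0']
    · intro h
      rw [h]
      refine ⟨by simp [hz], by simp [hz], fun r h0 h1 hd => by simp [hz, h0, h1, hd]⟩
  have := sum_update_dk z fun x => star (χ (x .dk)) * χ (x .dk)
  simp only [Function.update_self, hχ] at this
  rw [← this, initialState, Matrix.trace]
  refine Finset.sum_congr rfl fun x _ => ?_
  simp only [Matrix.diag_apply, Matrix.vecMulVec_apply, Pi.star_apply, initialVec, hcond x]
  split_ifs
  · rw [mul_comm]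
  · simp

theorem posSemidef_regProj_conj {ρ : Op sz} (hρ : ρ.PosSemidef) (m₀ : Bits (sz .msg0))
    (m₁ : Bits (sz .msg1)) :
    (regProj .msg0 m₀ * regProj .msg1 m₁ * ρ *
      (regProj .msg0 m₀ * regProj .msg1 m₁)).PosSemidef := by
  have h := hρ.mul_mul_conjTranspose_same (regProj .msg0 m₀ * regProj .msg1 m₁)
  have hM : (regProj (sz := sz) .msg0 m₀ * regProj .msg1 m₁)ᴴ =
      regProj .msg0 m₀ * regProj .msg1 m₁ := by
    rw [regProj, regProj, Matrix.diagonal_mul_diagonal, Matrix.diagonal_conjTranspose]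
    congr 1; funext x
    simp only [Pi.star_apply]
    split_ifs <;> simp
  rwa [hM] at h

theorem sum_trace_regProj_conj (ρ : Op sz) :
    ∑ m₀, ∑ m₁, (regProj .msg0 m₀ * regProj .msg1 m₁ * ρ *
      (regProj .msg0 m₀ * regProj .msg1 m₁)).trace = ρ.trace := by
  have h (m₀ : Bits (sz .msg0)) (m₁ : Bits (sz .msg1)) :
      (regProj .msg0 m₀ * regProj .msg1 m₁ * ρ * (regProj .msg0 m₀ * regProj .msg1 m₁)).trace =
        ∑ x : Basis sz, if x .msg0 = m₀ then (if x .msg1 = m₁ then ρ x x else 0) else 0 := by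
    rw [regProj, regProj, Matrix.diagonal_mul_diagonal, Matrix.trace]
    refine Finset.sum_congr rfl fun x _ => ?_
    rw [Matrix.diag_apply, Matrix.mul_diagonal, Matrix.diagonal_mul]
    split_ifs <;> simp
  simp only [h]
  rw [Finset.sum_congr rfl fun m₀ _ => Finset.sum_comm, Finset.sum_comm, Matrix.trace]
  refine Finset.sum_congr rfl fun x _ => ?_
  simp

end States

/-! ## Uniformity of the modified circuits -/

theorem query_not_mem_encodeGate (g : Gate) : CircuitSym.query ∉ encodeGate g := by
  rcases g with ⟨r, i⟩ | ⟨r, i⟩ | ⟨r, i⟩ | ⟨⟨r, i⟩, ⟨r', j⟩⟩ <;>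
    simp [encodeGate, encodeWire]

theorem flatMap_ite_of_not_mem {α : Type} [DecidableEq α] (a₀ : α) (w L : List α) (h : a₀ ∉ L) :
    L.flatMap (fun s => if s = a₀ then w else [s]) = L := by
  induction L with
  | nil => rfl
  | cons a L ih =>
    rw [List.mem_cons, not_or] at h
    rw [List.flatMap_cons, ih h.2, if_neg (Ne.symm h.1)]
    rfl

/-- The symbol `query` occurs in the encoding of an oracle call and nowhere else, so replacing
instructions amounts to replacing this one symbol in the written circuit. -/
theorem uniformCircuits_replaceQuery {C : ℕ → List Instr} (h : UniformCircuits C)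
    (L : List Instr) : UniformCircuits fun n => replaceQuery L (C n) := by
  classical
  obtain ⟨h⟩ := h
  refine h.subst_append CircuitSym.query (L.flatMap encodeInstr) [] fun n => ?_
  rw [List.append_nil, replaceQuery, List.flatMap_assoc, List.flatMap_assoc]
  congr 1
  funext i
  rcases i with g | ⟨r, i⟩ | r | _
  · exact (List.append_nil _).trans
      (flatMap_ite_of_not_mem _ _ _ (query_not_mem_encodeGate g)).symm
  · exact (List.append_nil _).trans
      (flatMap_ite_of_not_mem _ _ _ (by simp [encodeInstr, encodeWire])).symm
  · exact (List.append_nil _).trans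
      (flatMap_ite_of_not_mem _ _ _ (by simp [encodeInstr])).symm
  · simp [encodeInstr]

theorem uniformUnitaryCircuits_append {C : ℕ → List Gate} (h : UniformUnitaryCircuits C)
    (D : List Gate) : UniformUnitaryCircuits fun n => C n ++ D := by
  classical
  obtain ⟨h⟩ := h
  -- Only appending is needed; the substitution is made trivial.
  refine h.subst_append CircuitSym.query [.query] (D.flatMap encodeGate) fun n => ?_
  rw [List.flatMap_append, flatMap_ite_of_not_mem]
  simp only [List.mem_flatMap, not_exists, not_and]
  exact fun g _ => query_not_mem_encodeGate g

/-! ## The reduction -/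

namespace PKE

open scoped ComplexOrder

variable (S : PKE)

section Operators

variable {work n : ℕ}

theorem programOp_conjTranspose_mul_self {desc : ℕ} (prog : List Gate)
    (ct₀ ct₁ : Bits (S.ctLen n)) :
    (S.programOp prog ct₀ ct₁ : Op (S.layout work desc n))ᴴ * S.programOp prog ct₀ ct₁ = 1 :=
  conjTranspose_mul_mul_self (circuitOp_conjTranspose_mul_self _)
    (conjTranspose_mul_mul_self (writeOp_conjTranspose_mul_self _ _)
      (writeOp_conjTranspose_mul_self _ _))

theorem outProj_add_outProj_not {desc : ℕ} (b : Bool) :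
    outProj (S.layout work desc n) b + outProj (S.layout work desc n) (!b) = 1 := by
  rw [outProj, outProj, Matrix.diagonal_add, ← Matrix.diagonal_one]
  congr 1
  funext x
  have h (c : Bool) : (∀ i, x .out i = c) ↔ x .out (0 : Fin 1) = c :=
    ⟨fun h => h _, fun h i => by rwa [Subsingleton.elim (α := Fin 1) i 0]⟩
  simp only [h]
  cases x .out (0 : Fin 1) <;> cases b <;> simp

/-- The circuit that flips the output qubit. -/
def flipOut (flip : Bool) : List Gate := if flip then [.X (.out, 0)] else []

theorem flipOut_conj_outProj {desc : ℕ} (b : Bool) :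
    (circuitOp (S.layout work desc n) (flipOut true))ᴴ * outProj (S.layout work desc n) b *
      circuitOp (S.layout work desc n) (flipOut true) = outProj (S.layout work desc n) (!b) := by
  let i : Fin (S.layout work desc n .out) := (0 : Fin 1)
  have hc : circuitOp (S.layout work desc n) (flipOut true) = xOp .out i := by
    simp only [flipOut, if_true, circuitOp, Matrix.one_mul, gateOp]
    exact dif_pos (show 0 < 1 from one_pos)
  rw [hc, outProj, outProj, xOp, basisMapOp_conj_diagonal (flip_involutive _ _).injective]
  congr 1
  funext x
  have h (y : Basis (S.layout work desc n)) (c : Bool) : (∀ j, y .out j = c) ↔ y .out i = c :=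
    ⟨fun h => h _, fun h j => by rwa [Subsingleton.elim (α := Fin 1) j i]⟩
  simp only [h, setBit_apply_self]
  cases x .out i <;> cases b <;> simp

theorem guessProj_append_flipOut {desc : ℕ} (prog : List Gate) (b : Bool)
    (ct₀ ct₁ : Bits (S.ctLen n)) :
    (S.guessProj (prog ++ flipOut true) b ct₀ ct₁ : Op (S.layout work desc n)) =
      1 - S.guessProj prog b ct₀ ct₁ := by
  have h : (S.programOp (prog ++ flipOut true) ct₀ ct₁ : Op (S.layout work desc n)) =
      circuitOp _ (flipOut true) * S.programOp prog ct₀ ct₁ := by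
    rw [programOp, programOp, circuitOp_append, Matrix.mul_assoc]
  have hU := S.programOp_conjTranspose_mul_self (work := work) (desc := desc) prog ct₀ ct₁
  rw [guessProj, guessProj, h, eq_sub_iff_add_eq, Matrix.conjTranspose_mul]
  set U := (S.programOp prog ct₀ ct₁ : Op (S.layout work desc n))
  calc _ = Uᴴ * ((circuitOp (S.layout work desc n) (flipOut true))ᴴ *
        outProj (S.layout work desc n) b * circuitOp (S.layout work desc n) (flipOut true)) * U +
          Uᴴ * outProj _ b * U := by simp only [Matrix.mul_assoc]
    _ = Uᴴ * (outProj _ b + outProj _ (!b)) * U := by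
        rw [flipOut_conj_outProj, add_comm, mul_add, add_mul]
    _ = 1 := by rw [outProj_add_outProj_not, Matrix.mul_one, hU]

theorem posSemidef_mixedProj {desc : ℕ} (prog : List Gate) (e₀ e₁ : Bits (S.ekLen n))
    (m₀ m₁ : Bits (S.msgLen n)) :
    (S.mixedProj prog e₀ e₁ m₀ m₁ : Op (S.layout work desc n)).PosSemidef := by
  refine Matrix.posSemidef_sum _ fun r _ => Matrix.PosSemidef.smul ?_ (by positivity)
  refine Matrix.PosSemidef.conjTranspose_mul_mul_same (Matrix.PosSemidef.diagonal fun x => ?_) _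
  dsimp only
  split_ifs <;> simp

/-- Negating the output exchanges the two outcomes of the POVM. This yields the lower bound on the
success probability, and also `P ≤ 1`, since the complement is again an average of projections. -/
theorem mixedProj_append_flipOut {desc : ℕ} (prog : List Gate) (e₀ e₁ : Bits (S.ekLen n))
    (m₀ m₁ : Bits (S.msgLen n)) :
    (S.mixedProj (prog ++ flipOut true) e₀ e₁ m₀ m₁ : Op (S.layout work desc n)) =
      1 - S.mixedProj prog e₀ e₁ m₀ m₁ := by
  simp only [mixedProj, guessProj_append_flipOut, smul_sub, Finset.sum_sub_distrib,
    Finset.sum_const, Finset.card_univ]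
  congr 1
  rw [← Nat.cast_smul_eq_nsmul ℂ, smul_smul, mul_inv_cancel₀, one_smul]
  exact_mod_cast Fintype.card_ne_zero

theorem avg_re_trace_guessProj {desc : ℕ} (prog : List Gate) (e₀ e₁ : Bits (S.ekLen n))
    (m₀ m₁ : Bits (S.msgLen n)) (σ : Op (S.layout work desc n)) :
    (avg fun r : S.ChalCoins n =>
      (Matrix.trace (S.guessProj prog (S.challenge e₀ e₁ m₀ m₁ r).1
        (S.challenge e₀ e₁ m₀ m₁ r).2.1 (S.challenge e₀ e₁ m₀ m₁ r).2.2 * σ)).re) =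
      (Matrix.trace (S.mixedProj prog e₀ e₁ m₀ m₁ * σ)).re := by
  rw [mixedProj, Finset.sum_mul, Matrix.trace_sum, Complex.re_sum, avg, Finset.sum_div]
  refine Finset.sum_congr rfl fun r _ => ?_
  rw [Matrix.smul_mul, Matrix.trace_smul, smul_eq_mul, ← Complex.ofReal_natCast,
    ← Complex.ofReal_inv, Complex.re_ofReal_mul, div_eq_inv_mul]

end Operators

/-- The state of an adversary without oracle after it has sent the messages `m₀`, `m₁`. -/
def sentState {work : ℕ} (n : ℕ) (pre : List Instr)
    (k₀ k₁ : Bits (S.ekLen n) × Bits (S.dkLen n)) (m₀ m₁ : Bits (S.msgLen n)) :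
    Op (S.layout work 0 n) :=
  let sz := S.layout work 0 n
  let M : Op sz := regProj (sz := sz) .msg0 m₀ * regProj (sz := sz) .msg1 m₁
  M * runCircuit id pre (initialState (sz := sz) k₀.1 k₁.1 (leasedKey k₀.2 k₁.2)) * M

open Classical in
/-- The probability that the strong experiment outputs `1` if the key pairs are `k₀`, `k₁`, for an
adversary without program description. -/
def strongProbOfKeys (work : ℕ) (n : ℕ) (pre : List Instr) (prog : List Gate) (ε : ℝ)
    (k₀ k₁ : Bits (S.ekLen n) × Bits (S.dkLen n)) : ℝ :=
  ∑ m₀ : Bits (S.msgLen n), ∑ m₁ : Bits (S.msgLen n),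
    if m₀ ∈ S.msgSpace n ∧ m₁ ∈ S.msgSpace n then
      let P : Op (S.layout work 0 n) := S.mixedProj prog k₀.1 k₁.1 m₀ m₁
      ∑ p ∈ (projImpOutcomes P).filter (fun p => 1 / 2 + ε ≤ p),
        (Matrix.trace (projImp P p * S.sentState n pre k₀ k₁ m₀ m₁)).re
    else 0

open Classical in
-- The description length of the reduction is the value of the zero polynomial, and the types of the
-- operators depend on it. Keeping it as a variable `d` allows it to be replaced by `0` throughout;
-- the description then takes a single value and its projection is trivial.
theorem sum_description_eq (work n d : ℕ) (hd : d = 0) (pre : List Instr) (prog : List Gate)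
    (ε : ℝ) (k₀ k₁ : Bits (S.ekLen n) × Bits (S.dkLen n)) :
    (∑ m₀ : Bits (S.msgLen n), ∑ m₁ : Bits (S.msgLen n), ∑ u : Bits d,
      if m₀ ∈ S.msgSpace n ∧ m₁ ∈ S.msgSpace n then
        let P : Op (S.layout work d n) := S.mixedProj prog k₀.1 k₁.1 m₀ m₁
        let sz := S.layout work d n
        let M : Op sz := regProj (sz := sz) .msg0 m₀ * regProj (sz := sz) .msg1 m₁ *
          regProj (sz := sz) .desc u
        ∑ p ∈ (projImpOutcomes P).filter (fun p => 1 / 2 + ε ≤ p),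
          (Matrix.trace (projImp P p * (M *
            runCircuit id pre (initialState (sz := sz) k₀.1 k₁.1 (leasedKey k₀.2 k₁.2)) * M))).re
      else 0) = S.strongProbOfKeys work n pre prog ε k₀ k₁ := by
  subst hd
  have h (u : Bits 0) : regProj (sz := S.layout work 0 n) .desc u = 1 := by
    refine Eq.trans ?_ Matrix.diagonal_one
    refine congrArg Matrix.diagonal (funext fun x => ?_)
    exact if_pos (Subsingleton.elim (α := Fin 0 → Bool) _ _)
  refine Finset.sum_congr rfl fun m₀ _ => Finset.sum_congr rfl fun m₁ _ => ?_
  rw [Fintype.sum_unique]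
  simp only [h, Matrix.mul_one]
  rfl

/-- The strong adversary that runs a CoIC-KLA adversary, answers its oracle call by `v`, and sends
its second circuit as the program, with the output negated if `flip` holds. -/
def guessingAdversary (A : CoICAdversary) (v flip : Bool) : StrongAdversary where
  work := A.work
  desc := 0
  pre n := replaceQuery (constantAnswer v) (A.pre n)
  prog n := A.post n ++ flipOut flip
  pre_uniform := uniformCircuits_replaceQuery A.pre_uniform _
  prog_uniform := uniformUnitaryCircuits_append A.post_uniform _
  no_query n := query_not_mem_replaceQuery v (A.pre n)

end PKE

namespace PKE

open scoped ComplexOrder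

variable (S : PKE)

theorem strongProb_guessingAdversary (A : CoICAdversary) (v flip : Bool) (ε : ℝ) (n : ℕ) :
    S.strongProb (guessingAdversary A v flip) ε n =
      avg fun c : Bits (S.kgCoins.eval n) × Bits (S.kgCoins.eval n) =>
        S.strongProbOfKeys (A.work.eval n) n (replaceQuery (constantAnswer v) (A.pre n))
          (A.post n ++ flipOut flip) ε (S.kg n c.1) (S.kg n c.2) :=
  congrArg avg <| funext fun c => S.sum_description_eq (A.work.eval n) n
    ((guessingAdversary A v flip).desc.eval n) Polynomial.eval_zero
    (replaceQuery (constantAnswer v) (A.pre n)) (A.post n ++ flipOut flip) ε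
    (S.kg n c.1) (S.kg n c.2)

/-! ### Comparison of the two experiments -/

section Bounds

variable (A : CoICAdversary) (n : ℕ) (k₀ k₁ : Bits (S.ekLen n) × Bits (S.dkLen n))
  (m₀ m₁ : Bits (S.msgLen n))

/-- The amplitudes of the leased key in the key register. -/
def leasedVec (work : ℕ) : Bits (S.layout work 0 n .dk) → ℂ := leasedKey k₀.2 k₁.2

theorem sum_star_leasedVec_mul_self (work : ℕ) :
    ∑ s, star (S.leasedVec n k₀ k₁ work s) * S.leasedVec n k₀ k₁ work s = 1 :=
  sum_star_leasedKey_mul_self k₀.2 k₁.2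

/-- The state of a CoIC-KLA adversary before it sends its messages. -/
def stateBeforeMessages : Op (S.layout (A.work.eval n) 0 n) :=
  runCircuit (verifyOracle (S.leasedVec n k₀ k₁ (A.work.eval n))) (A.pre n)
    (initialState k₀.1 k₁.1 (S.leasedVec n k₀ k₁ (A.work.eval n)))

theorem posSemidef_stateBeforeMessages : (S.stateBeforeMessages A n k₀ k₁).PosSemidef :=
  (isChannel_runCircuit (isChannel_verifyOracle (S.sum_star_leasedVec_mul_self n k₀ k₁ _))
    _).posSemidef _ (posSemidef_initialState _ _ _)

theorem trace_stateBeforeMessages : (S.stateBeforeMessages A n k₀ k₁).trace = 1 :=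
  ((isChannel_runCircuit (isChannel_verifyOracle (S.sum_star_leasedVec_mul_self n k₀ k₁ _))
    _).trace_eq _).trans (trace_initialState _ _ (S.sum_star_leasedVec_mul_self n k₀ k₁ _))

theorem coicState_eq : S.coicState A n k₀ k₁ m₀ m₁ =
    regProj (sz := S.layout (A.work.eval n) 0 n) .msg0 m₀ *
      regProj (sz := S.layout (A.work.eval n) 0 n) .msg1 m₁ * S.stateBeforeMessages A n k₀ k₁ *
        (regProj (sz := S.layout (A.work.eval n) 0 n) .msg0 m₀ *
          regProj (sz := S.layout (A.work.eval n) 0 n) .msg1 m₁) := rfl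

theorem posSemidef_coicState : (S.coicState A n k₀ k₁ m₀ m₁).PosSemidef := by
  rw [coicState_eq]
  exact posSemidef_regProj_conj (sz := S.layout (A.work.eval n) 0 n)
    (S.posSemidef_stateBeforeMessages A n k₀ k₁) m₀ m₁

theorem sum_trace_coicState :
    ∑ m₀, ∑ m₁, (Matrix.trace (S.coicState A n k₀ k₁ m₀ m₁)).re = 1 := by
  have h := (sum_trace_regProj_conj (S.stateBeforeMessages A n k₀ k₁)).trans
    (S.trace_stateBeforeMessages A n k₀ k₁)
  have h' := congrArg Complex.re h
  simp only [Complex.re_sum, Complex.one_re] at h'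
  exact h'

/-- Projecting onto the sent messages is a conjugation by a Hermitian operator, so it preserves the
domination by the guessed runs. -/
theorem posSemidef_guess_sub_coicState :
    (S.sentState n (replaceQuery (constantAnswer false) (A.pre n)) k₀ k₁ m₀ m₁ +
      S.sentState n (replaceQuery (constantAnswer true) (A.pre n)) k₀ k₁ m₀ m₁ -
        S.coicState A n k₀ k₁ m₀ m₁).PosSemidef := by
  have h := posSemidef_regProj_conj (posSemidef_guess_sub_runCircuit
    (S.sum_star_leasedVec_mul_self n k₀ k₁ (A.work.eval n)) (A.pre n) (A.one_query n) _
      (posSemidef_initialState k₀.1 k₁.1 (S.leasedVec n k₀ k₁ (A.work.eval n)))) m₀ m₁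
  rw [mul_sub, mul_add, sub_mul, add_mul] at h
  exact h

open Classical in
/-- The probability that the CoIC-KLA experiment outputs `1` if the key pairs are `k₀`, `k₁`. -/
def coicProbOfKeys : ℝ :=
  ∑ m₀ : Bits (S.msgLen n), ∑ m₁ : Bits (S.msgLen n),
    if m₀ ∈ S.msgSpace n ∧ m₁ ∈ S.msgSpace n then
      (Matrix.trace ((S.mixedProj (A.post n) k₀.1 k₁.1 m₀ m₁ :
        Op (S.layout (A.work.eval n) 0 n)) * S.coicState A n k₀ k₁ m₀ m₁)).re
    else (1 / 2) * (Matrix.trace (S.coicState A n k₀ k₁ m₀ m₁)).re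

theorem coicProb_eq : S.coicProb A n =
    avg fun c : Bits (S.kgCoins.eval n) × Bits (S.kgCoins.eval n) =>
      S.coicProbOfKeys A n (S.kg n c.1) (S.kg n c.2) := by
  simp only [coicProb, coicProbOfKeys, avg_re_trace_guessProj]

theorem re_trace_mixedProj_mul_le {ε : ℝ} (hε : 0 ≤ ε) (prog : List Gate) :
    let P : Op (S.layout (A.work.eval n) 0 n) := S.mixedProj prog k₀.1 k₁.1 m₀ m₁
    (Matrix.trace (P * S.coicState A n k₀ k₁ m₀ m₁)).re ≤
      (1 / 2 + ε) * (Matrix.trace (S.coicState A n k₀ k₁ m₀ m₁)).re +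
        (∑ p ∈ (projImpOutcomes P).filter (fun p => 1 / 2 + ε ≤ p), (Matrix.trace (projImp P p *
            S.sentState n (replaceQuery (constantAnswer false) (A.pre n)) k₀ k₁ m₀ m₁)).re +
          ∑ p ∈ (projImpOutcomes P).filter (fun p => 1 / 2 + ε ≤ p), (Matrix.trace (projImp P p *
            S.sentState n (replaceQuery (constantAnswer true) (A.pre n)) k₀ k₁ m₀ m₁)).re) := by
  intro P
  refine re_trace_mul_le (S.posSemidef_mixedProj prog _ _ _ _) ?_
    (S.posSemidef_coicState A n k₀ k₁ m₀ m₁) (S.posSemidef_guess_sub_coicState A n k₀ k₁ m₀ m₁)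
    (by positivity)
  rw [← mixedProj_append_flipOut]
  exact S.posSemidef_mixedProj _ _ _ _ _

theorem coicProbOfKeys_le {ε : ℝ} (hε : 0 ≤ ε) : S.coicProbOfKeys A n k₀ k₁ ≤ 1 / 2 + ε +
    (S.strongProbOfKeys (A.work.eval n) n (replaceQuery (constantAnswer false) (A.pre n))
        (A.post n ++ flipOut false) ε k₀ k₁ +
      S.strongProbOfKeys (A.work.eval n) n (replaceQuery (constantAnswer true) (A.pre n))
        (A.post n ++ flipOut false) ε k₀ k₁) := by
  -- The message probabilities add up to one; spreading the constant over them allows a comparison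
  -- message by message.
  have h1 : 1 / 2 + ε = (1 / 2 + ε) *
      ∑ m₀, ∑ m₁, (Matrix.trace (S.coicState A n k₀ k₁ m₀ m₁)).re := by
    rw [sum_trace_coicState, mul_one]
  rw [show A.post n ++ flipOut false = A.post n from List.append_nil _, h1]
  simp only [coicProbOfKeys, strongProbOfKeys, Finset.mul_sum, ← Finset.sum_add_distrib]
  refine Finset.sum_le_sum fun m₀ _ => Finset.sum_le_sum fun m₁ _ => ?_
  split_ifs
  · exact S.re_trace_mixedProj_mul_le A n k₀ k₁ m₀ m₁ hε (A.post n)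
  -- An aborted run wins with probability `1/2`, which is within the bound because `ε ≥ 0`.
  · have := (Complex.nonneg_iff.mp (S.posSemidef_coicState A n k₀ k₁ m₀ m₁).trace_nonneg).1
    nlinarith

theorem one_sub_coicProbOfKeys_le {ε : ℝ} (hε : 0 ≤ ε) :
    1 - S.coicProbOfKeys A n k₀ k₁ ≤ 1 / 2 + ε +
    (S.strongProbOfKeys (A.work.eval n) n (replaceQuery (constantAnswer false) (A.pre n))
        (A.post n ++ flipOut true) ε k₀ k₁ +
      S.strongProbOfKeys (A.work.eval n) n (replaceQuery (constantAnswer true) (A.pre n))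
        (A.post n ++ flipOut true) ε k₀ k₁) := by
  have h1 : 1 / 2 + ε = (1 / 2 + ε) *
      ∑ m₀, ∑ m₁, (Matrix.trace (S.coicState A n k₀ k₁ m₀ m₁)).re := by
    rw [sum_trace_coicState, mul_one]
  have h2 : 1 - S.coicProbOfKeys A n k₀ k₁ =
      ∑ m₀, ∑ m₁, (Matrix.trace (S.coicState A n k₀ k₁ m₀ m₁)).re -
        S.coicProbOfKeys A n k₀ k₁ := by
    rw [sum_trace_coicState]
  rw [h2, h1]
  simp only [coicProbOfKeys, strongProbOfKeys, Finset.mul_sum, ← Finset.sum_add_distrib,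
    ← Finset.sum_sub_distrib]
  refine Finset.sum_le_sum fun m₀ _ => Finset.sum_le_sum fun m₁ _ => ?_
  split_ifs
  · refine le_trans (le_of_eq ?_)
      (S.re_trace_mixedProj_mul_le A n k₀ k₁ m₀ m₁ hε (A.post n ++ flipOut true))
    rw [mixedProj_append_flipOut, sub_mul, Matrix.one_mul, Matrix.trace_sub, Complex.sub_re]
  · have := (Complex.nonneg_iff.mp (S.posSemidef_coicState A n k₀ k₁ m₀ m₁).trace_nonneg).1
    nlinarith

theorem coicProb_le {ε : ℝ} (hε : 0 ≤ ε) : S.coicProb A n ≤ 1 / 2 + ε +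
    (S.strongProb (guessingAdversary A false false) ε n +
      S.strongProb (guessingAdversary A true false) ε n) := by
  simp only [coicProb_eq, strongProb_guessingAdversary]
  rw [← avg_add, ← avg_const (α := Bits (S.kgCoins.eval n) × Bits (S.kgCoins.eval n)) (1 / 2 + ε),
    ← avg_add]
  exact avg_mono fun c => S.coicProbOfKeys_le A n _ _ hε

theorem le_coicProb {ε : ℝ} (hε : 0 ≤ ε) :
    1 / 2 - ε - (S.strongProb (guessingAdversary A false true) ε n +
      S.strongProb (guessingAdversary A true true) ε n) ≤ S.coicProb A n := by
  simp only [coicProb_eq, strongProb_guessingAdversary]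
  rw [sub_eq_add_neg, ← avg_add, ← avg_neg,
    ← avg_const (α := Bits (S.kgCoins.eval n) × Bits (S.kgCoins.eval n)) (1 / 2 - ε), ← avg_add]
  refine avg_mono fun c => ?_
  have := S.one_sub_coicProbOfKeys_le A n (S.kg n c.1) (S.kg n c.2) hε
  linarith

/-- The advantage of a CoIC-KLA adversary is bounded by the success probabilities of the strong
adversaries built from it. -/
theorem abs_coicProb_sub_half_le {ε : ℝ} (hε : 0 ≤ ε) : |S.coicProb A n - 1 / 2| ≤ ε +
    ∑ b : Bool × Bool, |S.strongProb (guessingAdversary A b.1 b.2) ε n| := by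
  have h1 := S.coicProb_le A n hε
  have h2 := S.le_coicProb A n hε
  have h (v flip) := abs_nonneg (S.strongProb (guessingAdversary A v flip) ε n)
  have h' (v flip) := le_abs_self (S.strongProb (guessingAdversary A v flip) ε n)
  rw [Fintype.sum_prod_type]
  simp only [Fintype.sum_bool]
  rw [abs_le]
  constructor
  · linarith [h true false, h false false, h' true true, h' false true]
  · linarith [h true true, h false true, h' true false, h' false false]

end Bounds

end PKE

/-! ### Choice of the error parameter -/

theorem isInversePolynomial_one_div_pow (k : ℕ) :
    IsInversePolynomial fun n => 1 / ((n : ℝ) ^ (k + 1) + 1) :=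
  ⟨Polynomial.X ^ (k + 1) + 1, fun n => by simp⟩

/-- The expression is at most `1 / n` for `n > 0`. The summand `1` in the denominator only keeps the
polynomial positive at `n = 0`. -/
theorem tendsto_pow_mul_one_div_pow (k : ℕ) :
    Filter.Tendsto (fun n : ℕ => (n : ℝ) ^ k * (1 / ((n : ℝ) ^ (k + 1) + 1))) Filter.atTop
      (nhds 0) := by
  refine squeeze_zero' (Filter.Eventually.of_forall fun n => by positivity) ?_
    tendsto_one_div_atTop_nhds_zero_nat
  filter_upwards [Filter.eventually_gt_atTop 0] with n hn
  have : (0 : ℝ) < n := by exact_mod_cast hn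
  rw [mul_one_div, div_le_div_iff₀ (by positivity) this, pow_succ]
  linarith

end

theorem mainTheorem5 (S : PKE)
    (h : ∀ ε : ℕ → ℝ, IsInversePolynomial ε → S.IsStrongCoICKLASecure ε) :
    S.IsCoICKLASecure := by
  intro A k
  -- Negligibility is tested one exponent `k` at a time, so `ε` may depend on `k`; this is where
  -- security for every inverse polynomial is needed.
  set ε : ℕ → ℝ := fun n => 1 / ((n : ℝ) ^ (k + 1) + 1) with hε
  have hs (b : Bool × Bool) : Filter.Tendsto (fun n : ℕ => (n : ℝ) ^ k *
      |S.strongProb (PKE.guessingAdversary A b.1 b.2) (ε n) n|) Filter.atTop (nhds 0) := by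
    have := (h ε (isInversePolynomial_one_div_pow k) (PKE.guessingAdversary A b.1 b.2) k).abs
    simpa only [abs_zero, abs_mul, abs_pow, Nat.abs_cast] using this
  have hlim := ((tendsto_pow_mul_one_div_pow k).add
    (tendsto_finsetSum Finset.univ fun b _ => hs b)).const_mul 2
  simp only [Finset.sum_const_zero, add_zero, mul_zero] at hlim
  refine squeeze_zero (fun n => by positivity) (fun n => ?_) hlim
  have hn := S.abs_coicProb_sub_half_le A n (ε := ε n) (by positivity)
  calc (n : ℝ) ^ k * (2 * |S.coicProb A n - 1 / 2|)
      ≤ (n : ℝ) ^ k * (2 * (ε n +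
          ∑ b : Bool × Bool, |S.strongProb (PKE.guessingAdversary A b.1 b.2) (ε n) n|)) := by
        gcongr
    _ = _ := by rw [← Finset.mul_sum]; ring
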